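/- A metric graph $\mathcal G$ is given by a finite or countably infinite set $\mathsf E$ of edges, edge lengths $\ell_{\mathsf e}\in(0,\infty)$, and an equivalence relation on the set of endpoints of the disjoint union $\bigsqcup_{\mathsf e\in\mathsf E}[0,\ell_{\mathsf e}]$; $\mathcal G$ is the quotient space obtained by gluing the endpoints accordingly, and its vertices are the equivalence classes of endpoints (loops and parallel edges are allowed). The distance $\operatorname{dist}(x,y)\in[0,\infty]$ of two points is the infimum of the lengths of the chains $\xi_0,\theta_0,\dots,\xi_n,\theta_n$ such that $\xi_0$ represents $x$, $\theta_n$ represents $y$, $\xi_i,\theta_i$ lie on a common edge, and $\theta_i$ and $\xi_{i+1}$ represent the same point of $\mathcal G$; the length of the chain is $\sum_i|\xi_i-\theta_i|$. The graph is locally finite if every vertex contains only finitely many endpoints of edges, and connected if all distances are finite. Its length is $L=\sum_{\mathsf e}\ell_{\mathsf e}$, its diameter is $D=\sup_{x,y}\operatorname{dist}(x,y)$, and its first Betti number is the number of independent cycles, i.e. the dimension of the kernel of the boundary map from finite real combinations of edges to finite real combinations of vertices. Let $L^2(\mathcal G)=\bigoplus_{\mathsf e}L^2(0,\ell_{\mathsf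 e})$ (Hilbert sum of real spaces), and let $H^1(\mathcal G)$ be the space of all continuous $f:\mathcal G\to\mathbb R$ with $f\in L^2(\mathcal G)$ that are absolutely continuous on every edge and satisfy $f'\in L^2(\mathcal G)$. The Neumann extension $\mathcal H_{\mathrm N}$ is the operator in $L^2(\mathcal G)$ associated with the form $\int_{\mathcal G}u'v'\,dx$ with form domain $H^1(\mathcal G)$: $u\in\operatorname{dom}\mathcal H_{\mathrm N}$ and $\mathcal H_{\mathrm N}u=w$ if and only if $u\in H^1(\mathcal G)$, $w\in L^2(\mathcal G)$ and $\int_{\mathcal G}u'v'\,dx=\int_{\mathcal G}wv\,dx$ for all $v\in H^1(\mathcal G)$. **Proposition.** Let $\mathcal G$ be a locally finite, connected metric graph with finite length $L>0$, diameter $D>0$ and finite first Betti number. Then $\mathcal H_{\mathrm N}$ has purely discrete spectrum: there are eigenvalues $\mu_1\le\mu_2\le\mu_3\le\cdots\to\infty$ of $\mathcal H_{\mathrm N}$, repeated according to multiplicity, with an orthonormal basis of $L^2(\mathcal G)$ consisting of corresponding eigenfunctions. Moreover, $$\mu_2\ \ge\ \frac{2}{LD}.$$ -/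

import Mathlib

open MeasureTheory Filter Topology
open scoped ENNReal NNReal

noncomputable section

/-- A metric graph with edge set `E`: every edge `e` is an interval `[0, len e]` of finite positive
length, and `glue` is an arbitrary equivalence relation on the endpoints of the edges, where
`(e, false)` stands for the endpoint `0` of `e` and `(e, true)` for its endpoint `len e`.
Loops and parallel edges are allowed. -/
structure MetricGraph (E : Type*) where
  len : E → ℝ
  len_pos : ∀ e, 0 < len e
  glue : Setoid (E × Bool)

namespace MetricGraph

variable {E : Type*} (G : MetricGraph E)

/-- The vertices: the classes of endpoints. -/
def Vertex : Type _ := Quotient G.glue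

/-- The vertex at an endpoint of an edge. -/
def vertex (p : E × Bool) : G.Vertex := Quotient.mk G.glue p

/-- The disjoint union of the closed intervals `[0, len e]`. -/
abbrev EdgePoint : Type _ := Σ e : E, Set.Icc (0 : ℝ) (G.len e)

/-- The endpoints of the edges as points of the disjoint union. -/
def endpoint : E × Bool → G.EdgePoint
  | (e, false) => ⟨e, 0, le_refl _, (G.len_pos e).le⟩
  | (e, true) => ⟨e, G.len e, (G.len_pos e).le, le_refl _⟩

theorem endpoint_injective : Function.Injective G.endpoint := by
  have key : ∀ a b : G.EdgePoint, a = b → a.1 = b.1 ∧ (a.2 : ℝ) = b.2 := by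
    rintro a b rfl
    exact ⟨rfl, rfl⟩
  rintro ⟨e, b⟩ ⟨e', b'⟩ h
  obtain ⟨h1, h2⟩ := key _ _ h
  have hp := G.len_pos
  cases b <;> cases b' <;> simp only [endpoint] at h1 h2
  · rw [h1]
  · exact absurd h2 (hp e').ne
  · exact absurd h2 (hp e).ne'
  · rw [h1]

/-- The canonical extension of `glue` to the disjoint union of the edges. -/
def pointSetoid : Setoid G.EdgePoint where
  r a b := a = b ∨ ∃ p q, G.glue p q ∧ a = G.endpoint p ∧ b = G.endpoint q
  iseqv :=
    { refl := fun _ => Or.inl rfl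
      symm := by
        rintro a b (h | ⟨p, q, h, ha, hb⟩)
        · exact Or.inl h.symm
        · exact Or.inr ⟨q, p, G.glue.symm h, hb, ha⟩
      trans := by
        rintro a b c (rfl | ⟨p, q, h, ha, hb⟩) (h' | ⟨p', q', h', ha', hb'⟩)
        · exact Or.inl h'
        · exact Or.inr ⟨p', q', h', ha', hb'⟩
        · exact Or.inr ⟨p, q, h, ha, h' ▸ hb⟩
        · have hq : q = p' := G.endpoint_injective (hb.symm.trans ha')
          subst hq
          exact Or.inr ⟨p, q', G.glue.trans h h', ha, hb'⟩ }

/-- The points of the metric graph. -/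
def Point : Type _ := Quotient G.pointSetoid

/-- The point of the graph given by a point of an edge. -/
def point (a : G.EdgePoint) : G.Point := Quotient.mk G.pointSetoid a

/-- The parametrisation of an edge by arc length on `[0, len e]` (extended to the real line by
constants). The restriction of `f : G.Point → ℝ` to the edge `e` is `f ∘ G.edgeMap e`. -/
def edgeMap (e : E) (x : ℝ) : G.Point :=
  G.point ⟨e, Set.projIcc 0 (G.len e) (G.len_pos e).le x⟩

open scoped Classical in
/-- The distance on the disjoint union of the edges: `|x - y|` for two points of the same edge,
`∞` for two points of different edges. -/
def edgeDist (a b : G.EdgePoint) : ℝ≥0∞ :=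
  if a.1 = b.1 then ENNReal.ofReal |(a.2 : ℝ) - (b.2 : ℝ)| else ∞

theorem edgeDist_comm (a b : G.EdgePoint) : G.edgeDist a b = G.edgeDist b a := by
  simp only [edgeDist, abs_sub_comm (a.2 : ℝ)]
  by_cases h : a.1 = b.1
  · rw [if_pos h, if_pos h.symm]
  · rw [if_neg h, if_neg (Ne.symm h)]

/-- A chain `ξ₀, θ₀, …, ξₙ, θₙ` from `x` to `y`: `ξ₀` represents `x`, `θₙ` represents `y`, and
`θᵢ` is glued to `ξᵢ₊₁` (only the entries with index at most `n` matter). -/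
structure Chain (x y : G.Point) where
  n : ℕ
  ξ : ℕ → G.EdgePoint
  θ : ℕ → G.EdgePoint
  start : G.point (ξ 0) = x
  finish : G.point (θ n) = y
  glued : ∀ i < n, G.point (θ i) = G.point (ξ (i + 1))

/-- The length of a chain. -/
def Chain.length {G : MetricGraph E} {x y : G.Point} (c : G.Chain x y) : ℝ≥0∞ :=
  ∑ i ∈ Finset.range (c.n + 1), G.edgeDist (c.ξ i) (c.θ i)

theorem exists_chain_self (x : G.Point) : ∃ c : G.Chain x x, c.length = 0 := by
  obtain ⟨a, rfl⟩ := Quotient.exists_rep x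
  exact ⟨⟨0, fun _ => a, fun _ => a, rfl, rfl, by simp⟩, by simp [Chain.length, edgeDist]⟩

theorem exists_chain_symm {x y : G.Point} (c : G.Chain x y) :
    ∃ d : G.Chain y x, d.length = c.length := by
  refine ⟨⟨c.n, fun i => c.θ (c.n - i), fun i => c.ξ (c.n - i), by simpa using c.finish,
    by simpa using c.start, ?_⟩, ?_⟩
  · intro i hi
    have h := c.glued (c.n - (i + 1)) (by omega)
    rw [show c.n - (i + 1) + 1 = c.n - i by omega] at h
    exact h.symm
  · simp only [Chain.length]
    rw [← Finset.sum_range_reflect]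
    refine Finset.sum_congr rfl fun i hi => ?_
    have hi' := Finset.mem_range.1 hi
    rw [edgeDist_comm, show c.n - (c.n + 1 - 1 - i) = i by omega]

theorem exists_chain_trans {x y z : G.Point} (c : G.Chain x y) (d : G.Chain y z) :
    ∃ b : G.Chain x z, b.length = c.length + d.length := by
  refine ⟨⟨c.n + 1 + d.n, fun i => if i ≤ c.n then c.ξ i else d.ξ (i - (c.n + 1)),
    fun i => if i ≤ c.n then c.θ i else d.θ (i - (c.n + 1)), by simpa using c.start, ?_, ?_⟩, ?_⟩
  · have : ¬ (c.n + 1 + d.n ≤ c.n) := by omega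
    simpa [this] using d.finish
  · intro i hi
    rcases lt_trichotomy i c.n with h | h | h
    · simpa [h.le, Nat.succ_le_of_lt h] using c.glued i h
    · subst h
      simpa using c.finish.trans d.start.symm
    · have h1 : ¬ i ≤ c.n := by omega
      have h2 : ¬ i + 1 ≤ c.n := by omega
      have h3 := d.glued (i - (c.n + 1)) (by omega)
      rw [show i - (c.n + 1) + 1 = i + 1 - (c.n + 1) by omega] at h3
      simpa only [h1, h2, if_false] using h3
  · simp only [Chain.length]
    rw [show c.n + 1 + d.n + 1 = (c.n + 1) + (d.n + 1) by omega, Finset.sum_range_add]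
    congr 1
    · refine Finset.sum_congr rfl fun i hi => ?_
      have hi' : i ≤ c.n := Nat.lt_succ_iff.1 (Finset.mem_range.1 hi)
      simp [hi']
    · refine Finset.sum_congr rfl fun i _ => ?_
      have hi' : ¬ (c.n + 1 + i ≤ c.n) := by omega
      simp [hi']

/-- The canonical metric of the graph: the distance of two points is the infimum of the lengths of
the chains between them (`∞` if there is none). It also provides the topology. -/
instance instPseudoEMetricSpacePoint : PseudoEMetricSpace G.Point where
  edist x y := ⨅ c : G.Chain x y, c.length
  edist_self x := by
    obtain ⟨c, hc⟩ := G.exists_chain_self x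
    exact le_antisymm (hc ▸ iInf_le _ c) bot_le
  edist_comm x y := by
    refine le_antisymm (le_iInf fun c => ?_) (le_iInf fun c => ?_)
    all_goals
      obtain ⟨d, hd⟩ := G.exists_chain_symm c
      exact hd ▸ iInf_le _ d
  edist_triangle x y z := by
    refine ENNReal.le_iInf_add_iInf fun c d => ?_
    obtain ⟨b, hb⟩ := G.exists_chain_trans c d
    exact hb ▸ iInf_le _ b

/-- Every vertex has finite degree (loops are counted twice). -/
def LocallyFinite : Prop := ∀ v : G.Vertex, {p : E × Bool | G.vertex p = v}.Finite

/-- Any two points have finite distance. -/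
def Connected : Prop := ∀ x y : G.Point, edist x y < ∞

/-- The total length. -/
def totalLength : ℝ≥0∞ := ∑' e, ENNReal.ofReal (G.len e)

/-- The diameter. -/
def diam : ℝ≥0∞ := ⨆ (x : G.Point) (y : G.Point), edist x y

/-- The boundary map from real `1`-chains to real `0`-chains (every edge is oriented from its
endpoint `0` to its endpoint `len e`). -/
def boundary : (E →₀ ℝ) →ₗ[ℝ] (G.Vertex →₀ ℝ) :=
  Finsupp.linearCombination ℝ fun e =>
    Finsupp.single (G.vertex (e, true)) 1 - Finsupp.single (G.vertex (e, false)) 1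

/-- The first Betti number: the number of independent cycles, that is, the dimension of the cycle
space. -/
def bettiNumber : ℕ∞ := Cardinal.toENat (Module.rank ℝ (LinearMap.ker G.boundary))

/-- `L²(0, len e)` for an edge `e`. -/
abbrev EdgeL2 (e : E) : Type := Lp ℝ 2 (volume.restrict (Set.Icc (0 : ℝ) (G.len e)))

/-- `L²(G)`, the Hilbert sum of the spaces `L²(0, len e)`. -/
abbrev L2 : Type _ := lp (fun e => G.EdgeL2 e) 2

theorem intervalIntegrable_edge {e : E} (g : G.EdgeL2 e) {x : ℝ} (hx : x ∈ Set.Icc 0 (G.len e)) :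
    IntervalIntegrable g volume 0 x := by
  have h1 : IntegrableOn g (Set.Icc 0 (G.len e)) := (Lp.memLp g).integrable (by norm_num)
  rw [intervalIntegrable_iff_integrableOn_Icc_of_le hx.1]
  exact h1.mono_set (Set.Icc_subset_Icc_right hx.2)

theorem intervalIntegral_congr_edge {e : E} {g h : ℝ → ℝ}
    (hgh : g =ᵐ[volume.restrict (Set.Icc 0 (G.len e))] h) {x : ℝ} (hx : x ∈ Set.Icc 0 (G.len e)) :
    ∫ t in 0..x, g t = ∫ t in 0..x, h t := by
  rw [intervalIntegral.integral_of_le hx.1, intervalIntegral.integral_of_le hx.1]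
  refine integral_congr_ae (ae_mono (Measure.restrict_mono ?_ le_rfl) hgh)
  exact Set.Ioc_subset_Icc_self.trans (Set.Icc_subset_Icc_right hx.2)

/-- The Sobolev space `H¹(G)`, as the space of all pairs `(u, u')` in `L²(G) × L²(G)`: `u` is
represented by a function `f` that is continuous on the graph and whose restriction to each edge
is absolutely continuous with derivative `u'`. -/
def H1 : Submodule ℝ (G.L2 × G.L2) where
  carrier := {p | ∃ f : G.Point → ℝ, Continuous f ∧ ∀ e,
    (p.1 e : ℝ → ℝ) =ᵐ[volume.restrict (Set.Icc 0 (G.len e))] f ∘ G.edgeMap e ∧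
    ∀ x ∈ Set.Icc 0 (G.len e), f (G.edgeMap e x) = f (G.edgeMap e 0) + ∫ t in 0..x, p.2 e t}
  zero_mem' := by
    refine ⟨0, continuous_const, fun e => ⟨Lp.coeFn_zero _ _ _, fun x hx => ?_⟩⟩
    have h := G.intervalIntegral_congr_edge
      (Lp.coeFn_zero ℝ 2 (volume.restrict (Set.Icc 0 (G.len e)))) hx
    have h' : (∫ t in 0..x, ((0 : G.L2 × G.L2).2 e) t) = ∫ t in 0..x, (0 : ℝ → ℝ) t := h
    rw [h']
    simp
  add_mem' := by
    rintro p q ⟨f, hf, hf'⟩ ⟨g, hg, hg'⟩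
    refine ⟨f + g, hf.add hg, fun e => ⟨?_, fun x hx => ?_⟩⟩
    · filter_upwards [(hf' e).1, (hg' e).1, Lp.coeFn_add (p.1 e) (q.1 e)] with x h1 h2 h3
      exact h3.trans (congrArg₂ (· + ·) h1 h2)
    · have h : (∫ t in 0..x, (p + q).2 e t) = ∫ t in 0..x, (⇑(p.2 e) + ⇑(q.2 e)) t :=
        G.intervalIntegral_congr_edge (Lp.coeFn_add (p.2 e) (q.2 e)) hx
      rw [h]
      simp only [Pi.add_apply]
      rw [intervalIntegral.integral_add (G.intervalIntegrable_edge _ hx)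
        (G.intervalIntegrable_edge _ hx), (hf' e).2 x hx, (hg' e).2 x hx]
      ring
  smul_mem' := by
    rintro c p ⟨f, hf, hf'⟩
    refine ⟨c • f, hf.const_smul c, fun e => ⟨?_, fun x hx => ?_⟩⟩
    · filter_upwards [(hf' e).1, Lp.coeFn_smul c (p.1 e)] with x h1 h3
      exact h3.trans (congrArg (c • ·) h1)
    · have h : (∫ t in 0..x, (c • p).2 e t) = ∫ t in 0..x, (c • ⇑(p.2 e)) t :=
        G.intervalIntegral_congr_edge (Lp.coeFn_smul c (p.2 e)) hx
      rw [h]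
      simp only [Pi.smul_apply, smul_eq_mul]
      rw [intervalIntegral.integral_const_mul, (hf' e).2 x hx]
      ring

/-- The graph of the operator associated with the form `t[u, v] = ∫ u' v'` on `H¹(G)`: all pairs
`(u, w)` with `u ∈ H¹(G)` and `t[u, v] = ⟪w, v⟫` for every `v ∈ H¹(G)`. -/
def neumannGraph : Submodule ℝ (G.L2 × G.L2) where
  carrier := {p | ∃ u' : G.L2, (p.1, u') ∈ G.H1 ∧
    ∀ v v' : G.L2, (v, v') ∈ G.H1 → inner ℝ u' v' = inner ℝ p.2 v}
  zero_mem' := ⟨0, G.H1.zero_mem, fun v v' _ => by simp⟩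
  add_mem' := by
    rintro p q ⟨a, ha, ha'⟩ ⟨b, hb, hb'⟩
    refine ⟨a + b, G.H1.add_mem ha hb, fun v v' hv => ?_⟩
    rw [inner_add_left, ha' v v' hv, hb' v v' hv, Prod.snd_add, inner_add_left]
  smul_mem' := by
    rintro c p ⟨a, ha, ha'⟩
    refine ⟨c • a, G.H1.smul_mem c ha, fun v v' hv => ?_⟩
    rw [inner_smul_left, ha' v v' hv, Prod.smul_snd, inner_smul_left]

/-- A function that is `K`-Lipschitz on every edge is `K`-Lipschitz on the graph. -/
theorem lipschitzWith_of_edges {K : ℝ≥0} (hK : K ≠ 0) (f : G.Point → ℝ)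
    (h : ∀ (e : E) (x y : Set.Icc (0 : ℝ) (G.len e)),
      |f (G.point ⟨e, x⟩) - f (G.point ⟨e, y⟩)| ≤ K * |(x : ℝ) - y|) : LipschitzWith K f := by
  intro x y
  change _ ≤ K * ⨅ c : G.Chain x y, c.length
  rw [ENNReal.mul_iInf_of_ne (by simpa using hK) ENNReal.coe_ne_top]
  refine le_iInf fun c => ?_
  have hstep : ∀ a b : G.EdgePoint,
      edist (f (G.point a)) (f (G.point b)) ≤ K * G.edgeDist a b := by
    rintro ⟨e, a⟩ ⟨e', b⟩
    by_cases he : e = e'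
    · subst he
      simp only [edgeDist, if_true, edist_dist, Real.dist_eq]
      rw [← ENNReal.ofReal_coe_nnreal, ← ENNReal.ofReal_mul K.coe_nonneg]
      exact ENNReal.ofReal_le_ofReal (h e a b)
    · simp [edgeDist, he, hK]
  have key : ∀ m ≤ c.n, edist (f x) (f (G.point (c.θ m))) ≤
      ∑ i ∈ Finset.range (m + 1), K * G.edgeDist (c.ξ i) (c.θ i) := by
    intro m
    induction m with
    | zero =>
      intro _
      have h0 := hstep (c.ξ 0) (c.θ 0)
      rw [c.start] at h0
      simpa using h0
    | succ m ih =>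
      intro hm
      rw [Finset.sum_range_succ]
      refine (edist_triangle _ (f (G.point (c.θ m))) _).trans (add_le_add (ih (by omega)) ?_)
      rw [c.glued m (by omega)]
      exact hstep _ _
  have h1 := key c.n le_rfl
  rw [c.finish, ← Finset.mul_sum] at h1
  exact h1

open scoped Classical in
/-- `H¹(G)` is dense in `L²(G)`. -/
theorem eq_zero_of_orthogonal_H1 (w : G.L2)
    (hw : ∀ v v' : G.L2, (v, v') ∈ G.H1 → inner ℝ w v = 0) : w = 0 := by
  ext1
  funext e
  have hloc : IntegrableOn (w e) (Set.Icc 0 (G.len e)) :=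
    (Lp.memLp (w e)).integrable (by norm_num)
  have hz : ∀ᵐ x : ℝ, x ∈ Set.Ioo 0 (G.len e) → w e x = 0 := by
    refine isOpen_Ioo.ae_eq_zero_of_integral_contDiff_smul_eq_zero
      (hloc.mono_set Set.Ioo_subset_Icc_self).locallyIntegrableOn ?_
    intro φ hφ hcomp hsupp
    have hφ0 : ∀ x, x ∉ Set.Ioo 0 (G.len e) → φ x = 0 := fun x hx =>
      image_eq_zero_of_notMem_tsupport fun h => hx (hsupp h)
    have hd : Continuous (deriv φ) := hφ.continuous_deriv (by simp)
    obtain ⟨K, hK⟩ := hφ.lipschitzWith_of_hasCompactSupport hcomp (by simp)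
    let F : G.EdgePoint → ℝ := fun a => if a.1 = e then φ a.2 else 0
    have hend : ∀ p, F (G.endpoint p) = 0 := by
      rintro ⟨e', _ | _⟩ <;> simp only [F, endpoint] <;> split_ifs with he
      · exact hφ0 _ (by simp)
      · rfl
      · subst he; exact hφ0 _ (by simp)
      · rfl
    let f : G.Point → ℝ := Quotient.lift F (by
      rintro a b (h | ⟨p, q, _, rfl, rfl⟩)
      · rw [h]
      · rw [hend, hend])
    have hfF : ∀ a, f (G.point a) = F a := fun _ => rfl
    have hcont : Continuous f := by
      refine (G.lipschitzWith_of_edges (K := K + 1) (by positivity) f ?_).continuous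
      intro e' x y
      rw [hfF, hfF]
      simp only [F]
      split_ifs with he
      · have := hK.dist_le_mul x y
        rw [Real.dist_eq, Real.dist_eq] at this
        push_cast
        nlinarith [abs_nonneg ((x : ℝ) - y)]
      · simp; positivity
    have hedge : ∀ x ∈ Set.Icc 0 (G.len e), f (G.edgeMap e x) = φ x := by
      intro x hx
      simp [edgeMap, hfF, F, Set.projIcc_of_mem _ hx]
    have hedge' : ∀ e' ≠ e, ∀ x, f (G.edgeMap e' x) = 0 := by
      intro e' he' x
      simp [edgeMap, hfF, F, he']
    have hm : MemLp φ 2 (volume.restrict (Set.Icc 0 (G.len e))) :=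
      (hφ.continuous.memLp_of_hasCompactSupport hcomp).restrict _
    have hm' : MemLp (deriv φ) 2 (volume.restrict (Set.Icc 0 (G.len e))) :=
      (hd.memLp_of_hasCompactSupport hcomp.deriv).restrict _
    have hmem : ((lp.single 2 e (hm.toLp φ) : G.L2), (lp.single 2 e (hm'.toLp _) : G.L2)) ∈
        G.H1 := by
      refine ⟨f, hcont, fun e' => ?_⟩
      by_cases he : e' = e
      · subst he
        simp only [lp.single_apply_self]
        refine ⟨?_, fun x hx => ?_⟩
        · filter_upwards [hm.coeFn_toLp, ae_restrict_mem measurableSet_Icc] with x h1 h2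
          rw [h1, Function.comp_apply, hedge x h2]
        · rw [G.intervalIntegral_congr_edge hm'.coeFn_toLp hx, hedge x hx,
            hedge 0 ⟨le_rfl, (G.len_pos _).le⟩,
            intervalIntegral.integral_deriv_eq_sub
              (fun t _ => (hφ.differentiable (by simp)).differentiableAt)
              (hd.intervalIntegrable _ _)]
          ring
      · simp only [lp.single_apply_ne _ _ _ he]
        refine ⟨?_, fun x hx => ?_⟩
        · filter_upwards [Lp.coeFn_zero ℝ 2 (volume.restrict (Set.Icc 0 (G.len e')))] with x h1
          rw [h1, Function.comp_apply, hedge' e' he]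
          rfl
        · rw [G.intervalIntegral_congr_edge (Lp.coeFn_zero ℝ 2 _) hx, hedge' e' he, hedge' e' he]
          simp
    have h1 := hw _ _ hmem
    rw [lp.inner_single_right, L2.inner_def] at h1
    rw [← setIntegral_eq_integral_of_forall_compl_eq_zero
      (s := Set.Icc 0 (G.len e)) (fun x hx => by
        rw [hφ0 x fun h => hx (Set.Ioo_subset_Icc_self h), zero_smul])]
    refine Eq.trans (integral_congr_ae ?_) h1
    filter_upwards [hm.coeFn_toLp] with x hx
    simp [hx]
  have hz' : ∀ᵐ x ∂volume.restrict (Set.Icc 0 (G.len e)), w e x = 0 := by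
    rw [ae_restrict_congr_set Ioo_ae_eq_Icc.symm]
    exact (ae_restrict_iff' measurableSet_Ioo).2 hz
  exact (Lp.eq_zero_iff_ae_eq_zero).2 hz'

/-- `neumannGraph` is the graph of an operator. -/
theorem neumannGraph_single_valued (x : G.L2 × G.L2) (hx : x ∈ G.neumannGraph)
    (hx0 : x.1 = 0) : x.2 = 0 := by
  obtain ⟨u', hu, h⟩ := hx
  have h0 : inner ℝ u' u' = 0 := by
    rw [h x.1 u' hu, hx0, inner_zero_right]
  rw [inner_self_eq_zero.1 h0] at h
  exact G.eq_zero_of_orthogonal_H1 _ fun v v' hv => by rw [← h v v' hv, inner_zero_left]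

/-- The Neumann extension of the Laplacian: the operator in `L²(G)` associated with the form
`∫ u' v'` with form domain `H¹(G)`. -/
def neumannLaplacian : G.L2 →ₗ.[ℝ] G.L2 := G.neumannGraph.toLinearPMap

end MetricGraph

/-- `μ 0 ≤ μ 1 ≤ μ 2 ≤ …` are the ordered eigenvalues of the operator `T`, repeated according to
their multiplicities, and the spectrum of `T` is purely discrete: `μ` tends to `∞`, and the space
has an orthonormal basis of eigenvectors `ψ k` of `T` for the eigenvalues `μ k`. -/
def IsEigenvalueSequence {H : Type*} [NormedAddCommGroup H] [InnerProductSpace ℝ H]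
    (T : H →ₗ.[ℝ] H) (μ : ℕ → ℝ) : Prop :=
  Monotone μ ∧ Tendsto μ atTop atTop ∧
    ∃ ψ : HilbertBasis ℕ ℝ H, ∀ k, ∃ h : ψ k ∈ T.domain, T ⟨ψ k, h⟩ = μ k • ψ k

end

/-! ### Chains and the Hölder estimate along them -/

namespace MetricGraph

variable {E : Type*} (G : MetricGraph E)

/-! Everything rests on the estimate `(f x - f y)^2 ≤ dist(x, y) * ‖f'‖^2` for `f` in `H¹`. Along a
chain whose pieces do not overlap, the fundamental theorem of calculus and Cauchy–Schwarz give it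
with the length of the chain. Overlapping pieces can be merged without lengthening the chain, so it
holds for every chain of finite length (`IsRep.sq_sub_le_length`), and `D` bounds the distance.

Integrating over `y` gives `‖f x • 1 - f‖^2 ≤ L D ‖f'‖^2`. If `f` has mean zero, the left side is `L
* f x ^ 2 + ‖f‖^2`; integrating over `x` as well yields `2 ‖f‖^2 ≤ L D ‖f'‖^2` (`IsRep.poincare`).
Some nonzero combination of the first two eigenfunctions has mean zero, and its Rayleigh quotient is
at most the second eigenvalue, whence the bound `2 / (L D)`.

Without the mean condition the same estimate bounds `sup |f|` by the `H¹` norm. Hence `H¹` is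
complete and its embedding `J` into `L²` is compact: step functions approximate on each edge, and
the edges outside a large finite set have small total length. The operator `J J*` is compact,
symmetric and positive, and injective because `H¹` is dense. It is the inverse of the Neumann
operator plus `1`, so an eigenvalue `c` of `J J*` gives the Neumann eigenvalue `c⁻¹ - 1`. -/

theorem edgeDist_triangle (a b c : G.EdgePoint) :
    G.edgeDist a c ≤ G.edgeDist a b + G.edgeDist b c := by
  by_cases h1 : a.1 = b.1
  · by_cases h2 : b.1 = c.1
    · simp only [edgeDist, h1, h2, if_true]
      rw [← ENNReal.ofReal_add (abs_nonneg _) (abs_nonneg _)]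
      exact ENNReal.ofReal_le_ofReal (abs_sub_le _ _ _)
    · simp [edgeDist, h2]
  · simp [edgeDist, h1]

variable {G}

/-- Two pieces of a chain that meet can be merged into a single piece. -/
theorem Chain.exists_merge {x y : G.Point} (c : G.Chain x y) {i j : ℕ} (hij : i < j)
    (hj : j ≤ c.n) (t : G.EdgePoint)
    (h1 : G.edgeDist (c.ξ i) t ≤ G.edgeDist (c.ξ i) (c.θ i))
    (h2 : G.edgeDist t (c.θ j) ≤ G.edgeDist (c.ξ j) (c.θ j)) :
    ∃ d : G.Chain x y, d.n < c.n ∧ d.length ≤ c.length := by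
  obtain ⟨a, rfl⟩ := Nat.exists_eq_add_of_lt hij
  obtain ⟨b, hb⟩ := Nat.exists_eq_add_of_le hj
  -- With `j = i + a + 1`, the pieces `i, …, j` become the single piece from `ξ i` to `θ j`, at
  -- index `i`. So `ξ` is shifted after `i`, but `θ` already from `i` on.
  refine ⟨⟨i + b, fun k => if k ≤ i then c.ξ k else c.ξ (k + (a + 1)),
    fun k => if k < i then c.θ k else c.θ (k + (a + 1)), by simpa using c.start, ?_, ?_⟩,
    by simp only; omega, ?_⟩
  · have : ¬ i + b < i := by omega
    simp only [this, if_false]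
    rw [show i + b + (a + 1) = c.n by omega]
    exact c.finish
  · intro k hk
    by_cases hki : k < i
    · simpa [hki, Nat.succ_le_of_lt hki] using c.glued k (by omega)
    · have h3 := c.glued (k + (a + 1)) (by omega)
      have h4 : ¬ k + 1 ≤ i := by omega
      simp only [hki, h4, if_false]
      rw [show k + 1 + (a + 1) = k + (a + 1) + 1 by omega]
      exact h3
  · simp only [Chain.length]
    rw [show c.n + 1 = i + (1 + (a + (1 + b))) by omega, show i + b + 1 = i + (1 + b) by omega]
    simp only [Finset.sum_range_add, Finset.sum_range_one]
    refine add_le_add (Finset.sum_le_sum fun k hk => ?_) ?_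
    · have := Finset.mem_range.1 hk
      simp [this, this.le]
    · have e1 : ∑ k ∈ Finset.range b,
          G.edgeDist (if i + (1 + k) ≤ i then c.ξ (i + (1 + k)) else c.ξ (i + (1 + k) + (a + 1)))
            (if i + (1 + k) < i then c.θ (i + (1 + k)) else c.θ (i + (1 + k) + (a + 1))) =
          ∑ k ∈ Finset.range b,
            G.edgeDist (c.ξ (i + (1 + (a + (1 + k))))) (c.θ (i + (1 + (a + (1 + k))))) := by
        refine Finset.sum_congr rfl fun k _ => ?_
        have h3 : ¬ i + (1 + k) ≤ i := by omega
        have h4 : ¬ i + (1 + k) < i := by omega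
        simp only [h3, h4, if_false]
        rw [show i + (1 + k) + (a + 1) = i + (1 + (a + (1 + k))) by omega]
      rw [e1]
      have e2 : G.edgeDist (c.ξ i) (c.θ (i + a + 1)) ≤
          G.edgeDist (c.ξ i) (c.θ i) + G.edgeDist (c.ξ (i + a + 1)) (c.θ (i + a + 1)) :=
        (G.edgeDist_triangle _ t _).trans (add_le_add h1 h2)
      simp only [add_zero, le_refl, if_true, lt_irrefl, if_false]
      rw [show i + (a + 1) = i + a + 1 by omega, show i + (1 + a) = i + a + 1 by omega]
      refine (add_le_add_left e2 _).trans ?_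
      rw [add_assoc]
      exact add_le_add_right le_add_self _

end MetricGraph

/-- The Cauchy–Schwarz inequality for the integral of a single function. -/
theorem sq_integral_le_measureReal_mul {α : Type*} [MeasurableSpace α] {μ : Measure α}
    [IsFiniteMeasure μ] {g : α → ℝ} (hg : MemLp g 2 μ) :
    (∫ t, g t ∂μ) ^ 2 ≤ μ.real Set.univ * ∫ t, g t ^ 2 ∂μ := by
  have hi : Integrable g μ := hg.integrable (by norm_num)
  have hs : Integrable (fun t => g t ^ 2) μ := hg.integrable_sq
  set V := μ.real Set.univ with hV
  set I := ∫ t, g t ∂μ with hI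
  set Q := ∫ t, g t ^ 2 ∂μ
  rcases (measureReal_nonneg : 0 ≤ μ.real Set.univ).eq_or_lt with h0 | h0
  · have : μ = 0 := by
      rw [eq_comm, measureReal_eq_zero_iff] at h0
      exact Measure.measure_univ_eq_zero.1 h0
    have hI0 : I = 0 := by rw [hI, this]; simp
    rw [hI0, hV, ← h0]; simp
  -- The variance of `g`, scaled by `V` to avoid division; it expands to `V * (V * Q - I ^ 2)`.
  · have h : 0 ≤ ∫ t, (V * g t - I) ^ 2 ∂μ := integral_nonneg fun t => sq_nonneg _
    have e : ∫ t, (V * g t - I) ^ 2 ∂μ = V ^ 2 * Q - 2 * V * I * I + V * I ^ 2 := by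
      have : ∀ t, (V * g t - I) ^ 2 = V ^ 2 * g t ^ 2 - 2 * V * I * g t + I ^ 2 := fun t => by ring
      simp_rw [this]
      have i1 : Integrable (fun t => V ^ 2 * g t ^ 2) μ := hs.const_mul _
      have i2 : Integrable (fun t => 2 * V * I * g t) μ := hi.const_mul _
      have i3 : Integrable (fun t => V ^ 2 * g t ^ 2 - 2 * V * I * g t) μ := i1.sub i2
      rw [integral_add i3 (integrable_const _), integral_sub i1 i2, integral_const_mul,
        integral_const_mul, integral_const, smul_eq_mul]
    rw [e] at h
    have : 0 ≤ V * (V * Q - I ^ 2) := by nlinarith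
    have := nonneg_of_mul_nonneg_right this h0
    linarith

namespace MetricGraph

variable {E : Type*} (G : MetricGraph E)

theorem norm_edgeL2_sq {e : E} (g : G.EdgeL2 e) :
    ‖g‖ ^ 2 = ∫ t in Set.Icc 0 (G.len e), g t ^ 2 := by
  rw [← real_inner_self_eq_norm_sq, L2.inner_def]
  simp [sq]

theorem hasSum_norm_sq (w : G.L2) : HasSum (fun e => ‖w e‖ ^ 2) (‖w‖ ^ 2) := by
  have := lp.hasSum_norm (p := 2) (by norm_num) w
  simpa using this

theorem sum_norm_sq_le (w : G.L2) (s : Finset E) : ∑ e ∈ s, ‖w e‖ ^ 2 ≤ ‖w‖ ^ 2 :=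
  sum_le_hasSum s (fun _ _ => sq_nonneg _) (G.hasSum_norm_sq w)

theorem sum_setIntegral_sq_le (w : G.L2) {ι : Type*} (s : Finset ι) (e : ι → E) (S : ι → Set ℝ)
    (hS : ∀ i ∈ s, MeasurableSet (S i)) (hsub : ∀ i ∈ s, S i ⊆ Set.Icc 0 (G.len (e i)))
    (hdisj : ∀ i ∈ s, ∀ j ∈ s, i ≠ j → e i = e j → Disjoint (S i) (S j)) :
    ∑ i ∈ s, ∫ t in S i, w (e i) t ^ 2 ≤ ‖w‖ ^ 2 := by
  classical
  refine le_trans ?_ (G.sum_norm_sq_le w (s.image e))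
  rw [← Finset.sum_fiberwise_of_maps_to (t := s.image e) (g := e)
    fun i hi => Finset.mem_image_of_mem _ hi]
  refine Finset.sum_le_sum fun e' _ => ?_
  have hint : IntegrableOn (fun t => w e' t ^ 2) (Set.Icc 0 (G.len e')) :=
    (Lp.memLp (w e')).integrable_sq
  have h1 : ∑ i ∈ s with e i = e', ∫ t in S i, w (e i) t ^ 2 =
      ∑ i ∈ s with e i = e', ∫ t in S i, w e' t ^ 2 :=
    Finset.sum_congr rfl fun i hi => by rw [(Finset.mem_filter.1 hi).2]
  have hsub' : ∀ i ∈ s.filter (e · = e'), S i ⊆ Set.Icc 0 (G.len e') := fun i hi => by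
    obtain ⟨h, h'⟩ := Finset.mem_filter.1 hi
    exact h' ▸ hsub i h
  rw [h1, ← integral_biUnion_finset, norm_edgeL2_sq]
  · exact setIntegral_mono_set hint (ae_of_all _ fun t => sq_nonneg _)
      (Set.iUnion₂_subset hsub').eventuallyLE
  · exact fun i hi => hS i (Finset.mem_filter.1 hi).1
  · intro i hi j hj hij
    obtain ⟨h, h'⟩ := Finset.mem_filter.1 (Finset.mem_coe.1 hi)
    obtain ⟨k, k'⟩ := Finset.mem_filter.1 (Finset.mem_coe.1 hj)
    exact hdisj i h j k hij (h'.trans k'.symm)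
  · exact fun i hi => hint.mono_set (hsub' i hi)

/-- `f` is the continuous representative of the pair `p = (u, u')`. -/
def IsRep (f : G.Point → ℝ) (p : G.L2 × G.L2) : Prop :=
  Continuous f ∧ ∀ e,
    (p.1 e : ℝ → ℝ) =ᵐ[volume.restrict (Set.Icc 0 (G.len e))] f ∘ G.edgeMap e ∧
    ∀ x ∈ Set.Icc 0 (G.len e), f (G.edgeMap e x) = f (G.edgeMap e 0) + ∫ t in 0..x, p.2 e t

theorem mem_H1_iff {p : G.L2 × G.L2} : p ∈ G.H1 ↔ ∃ f, G.IsRep f p := Iff.rfl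

variable {G}

/-- The difference is the integral of the derivative between `b` and `a`, to which Cauchy–Schwarz
applies. Keeping the integral local lets disjoint pieces of one edge be summed later. -/
theorem IsRep.sq_sub_le_edge {f : G.Point → ℝ} {p : G.L2 × G.L2} (hf : G.IsRep f p) {e : E}
    {a b : ℝ} (ha : a ∈ Set.Icc 0 (G.len e)) (hb : b ∈ Set.Icc 0 (G.len e)) :
    (f (G.edgeMap e a) - f (G.edgeMap e b)) ^ 2 ≤
      |a - b| * ∫ t in Set.uIoc a b, p.2 e t ^ 2 := by
  have hsub : Set.uIoc a b ⊆ Set.Icc 0 (G.len e) := Set.uIoc_subset_uIcc.trans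
    (Set.uIcc_subset_Icc ha hb)
  have h1 : f (G.edgeMap e a) - f (G.edgeMap e b) = ∫ t in b..a, p.2 e t := by
    rw [(hf.2 e).2 a ha, (hf.2 e).2 b hb, ← intervalIntegral.integral_interval_sub_left
      (G.intervalIntegrable_edge _ ha) (G.intervalIntegrable_edge _ hb)]
    ring
  have : IsFiniteMeasure (volume.restrict (Set.uIoc a b)) :=
    ⟨by rw [Measure.restrict_apply_univ, Real.volume_uIoc]; exact ENNReal.ofReal_lt_top⟩
  have hm : MemLp (p.2 e) 2 (volume.restrict (Set.uIoc a b)) :=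
    (Lp.memLp (p.2 e)).mono_measure (Measure.restrict_mono hsub le_rfl)
  have h2 := sq_integral_le_measureReal_mul hm
  rw [h1, ← sq_abs, intervalIntegral.abs_intervalIntegral_eq, sq_abs, Set.uIoc_comm]
  refine h2.trans_eq ?_
  congr 1
  rw [measureReal_restrict_apply_univ, Measure.real, Real.volume_uIoc, ENNReal.toReal_ofReal
    (abs_nonneg _), abs_sub_comm]

/-- Strong induction on the number of pieces. If some chain with fewer pieces is no longer, it does
the work; otherwise no two pieces overlap, since a common point would allow a merge. Then the local
integrals of `f'^2` sum to at most `‖f'‖^2`, and Cauchy–Schwarz for sums finishes. -/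
theorem IsRep.sq_sub_le_length {f : G.Point → ℝ} {p : G.L2 × G.L2} (hf : G.IsRep f p)
    {x y : G.Point} (c : G.Chain x y) (hc : c.length ≠ ∞) :
    (f x - f y) ^ 2 ≤ c.length.toReal * ‖p.2‖ ^ 2 := by
  induction hn : c.n using Nat.strong_induction_on generalizing c with
  | _ n ih =>
  subst hn
  by_cases hmerge : ∃ d : G.Chain x y, d.n < c.n ∧ d.length ≤ c.length
  · obtain ⟨d, hd, hd'⟩ := hmerge
    refine (ih d.n hd d (ne_top_of_le_ne_top hc hd') rfl).trans ?_
    exact mul_le_mul_of_nonneg_right (ENNReal.toReal_mono hc hd') (sq_nonneg _)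
  have hfin : ∀ i ∈ Finset.range (c.n + 1), G.edgeDist (c.ξ i) (c.θ i) ≠ ∞ :=
    fun i hi => (ENNReal.sum_ne_top.1 hc) i hi
  have hedge : ∀ i ∈ Finset.range (c.n + 1), (c.ξ i).1 = (c.θ i).1 := fun i hi => by
    by_contra h
    exact hfin i hi (by simp [edgeDist, h])
  let a : ℕ → ℝ := fun i => (c.ξ i).2
  let b : ℕ → ℝ := fun i => (c.θ i).2
  have hdist : ∀ i ∈ Finset.range (c.n + 1),
      (G.edgeDist (c.ξ i) (c.θ i)).toReal = |a i - b i| := fun i hi => by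
    simp [edgeDist, hedge i hi, a, b]
  have hpt : ∀ q : G.EdgePoint, G.point q = G.edgeMap q.1 q.2 := by
    rintro ⟨e, q⟩
    simp [edgeMap]
  have hb : ∀ i ∈ Finset.range (c.n + 1), b i ∈ Set.Icc 0 (G.len (c.ξ i).1) := fun i hi => by
    rw [hedge i hi]; exact (c.θ i).2.2
  let I : ℕ → ℝ := fun i => ∫ t in Set.uIoc (a i) (b i), p.2 (c.ξ i).1 t ^ 2
  have hI0 : ∀ i, 0 ≤ I i := fun i => integral_nonneg fun t => sq_nonneg _
  have hstep : ∀ i ∈ Finset.range (c.n + 1),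
      |f (G.point (c.ξ i)) - f (G.point (c.θ i))| ≤ √|a i - b i| * √(I i) := fun i hi => by
    rw [← Real.sqrt_mul (abs_nonneg _)]
    refine Real.abs_le_sqrt ?_
    have he : G.point (c.θ i) = G.edgeMap (c.ξ i).1 (b i) := by rw [hpt, hedge i hi]
    rw [hpt (c.ξ i), he]
    exact hf.sq_sub_le_edge (c.ξ i).2.2 (hb i hi)
  have htel : ∀ m ≤ c.n, |f x - f (G.point (c.θ m))| ≤
      ∑ i ∈ Finset.range (m + 1), |f (G.point (c.ξ i)) - f (G.point (c.θ i))| := by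
    intro m
    induction m with
    | zero => intro _; simp [c.start]
    | succ m ihm =>
      intro hm
      rw [Finset.sum_range_succ]
      refine (abs_sub_le _ (f (G.point (c.θ m))) _).trans (add_le_add (ihm (by omega)) ?_)
      rw [c.glued m (by omega)]
  have h1 : |f x - f y| ≤ ∑ i ∈ Finset.range (c.n + 1), √|a i - b i| * √(I i) := by
    have := htel c.n le_rfl
    rw [c.finish] at this
    exact this.trans (Finset.sum_le_sum hstep)
  have h2 : (∑ i ∈ Finset.range (c.n + 1), √|a i - b i| * √(I i)) ^ 2 ≤
      (∑ i ∈ Finset.range (c.n + 1), |a i - b i|) * ∑ i ∈ Finset.range (c.n + 1), I i := by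
    have := Finset.sum_mul_sq_le_sq_mul_sq (Finset.range (c.n + 1)) (fun i => √|a i - b i|)
      (fun i => √(I i))
    simpa only [Real.sq_sqrt (abs_nonneg _), Real.sq_sqrt (hI0 _)] using this
  have h3 : ∑ i ∈ Finset.range (c.n + 1), |a i - b i| = c.length.toReal := by
    rw [Chain.length, ENNReal.toReal_sum hfin]
    exact Finset.sum_congr rfl fun i hi => (hdist i hi).symm
  have hdisj : ∀ i ∈ Finset.range (c.n + 1), ∀ j ∈ Finset.range (c.n + 1), i < j →
      (c.ξ i).1 = (c.ξ j).1 → Disjoint (Set.uIoc (a i) (b i)) (Set.uIoc (a j) (b j)) := by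
    intro i hi j hj hij he
    rw [Set.disjoint_left]
    intro t ht ht'
    refine hmerge (c.exists_merge hij (Nat.lt_succ_iff.1 (Finset.mem_range.1 hj))
      ⟨(c.ξ i).1, t, Set.uIcc_subset_Icc (c.ξ i).2.2 (hb i hi) (Set.uIoc_subset_uIcc ht)⟩ ?_ ?_)
    · simp only [edgeDist, hedge i hi, if_true]
      refine ENNReal.ofReal_le_ofReal ?_
      rw [abs_sub_comm _ t, abs_sub_comm _ (b i)]
      exact Set.abs_sub_left_of_mem_uIcc (Set.uIoc_subset_uIcc ht)
    · simp only [edgeDist, he, hedge j hj, if_true]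
      refine ENNReal.ofReal_le_ofReal ?_
      rw [abs_sub_comm t, abs_sub_comm _ (b j)]
      exact Set.abs_sub_right_of_mem_uIcc (Set.uIoc_subset_uIcc ht')
  have h4 : ∑ i ∈ Finset.range (c.n + 1), I i ≤ ‖p.2‖ ^ 2 := by
    refine G.sum_setIntegral_sq_le p.2 _ (fun i => (c.ξ i).1) _ (fun i _ => measurableSet_uIoc)
      (fun i hi => Set.uIoc_subset_uIcc.trans (Set.uIcc_subset_Icc (c.ξ i).2.2 (hb i hi))) ?_
    intro i hi j hj hij he
    rcases lt_or_gt_of_ne hij with h | h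
    · exact hdisj i hi j hj h he
    · exact (hdisj j hj i hi h he.symm).symm
  calc (f x - f y) ^ 2 = |f x - f y| ^ 2 := (sq_abs _).symm
    _ ≤ (∑ i ∈ Finset.range (c.n + 1), √|a i - b i| * √(I i)) ^ 2 :=
      pow_le_pow_left₀ (abs_nonneg _) h1 2
    _ ≤ _ := h2
    _ ≤ c.length.toReal * ‖p.2‖ ^ 2 := by
      rw [h3]; exact mul_le_mul_of_nonneg_left h4 ENNReal.toReal_nonneg

theorem IsRep.sq_sub_le_diam {f : G.Point → ℝ} {p : G.L2 × G.L2} (hf : G.IsRep f p)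
    {D : ℝ} (hD : 0 ≤ D) (hdiam : G.diam ≤ ENNReal.ofReal D) (x y : G.Point) :
    (f x - f y) ^ 2 ≤ D * ‖p.2‖ ^ 2 := by
  -- The distance is an infimum over chains, so a chain of length below `D + ε` is used.
  have h : ∀ ε : ℝ, 0 < ε → (f x - f y) ^ 2 ≤ (D + ε) * ‖p.2‖ ^ 2 := by
    intro ε hε
    have h1 : ⨅ c : G.Chain x y, c.length < ENNReal.ofReal (D + ε) := by
      refine lt_of_le_of_lt (b := G.diam) ?_ (hdiam.trans_lt ?_)
      · exact le_iSup₂_of_le x y le_rfl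
      · exact (ENNReal.ofReal_lt_ofReal_iff (by linarith)).2 (by linarith)
    obtain ⟨c, hc⟩ := iInf_lt_iff.1 h1
    refine (hf.sq_sub_le_length c hc.ne_top).trans ?_
    refine mul_le_mul_of_nonneg_right ?_ (sq_nonneg _)
    have := ENNReal.toReal_mono ENNReal.ofReal_ne_top hc.le
    rwa [ENNReal.toReal_ofReal (by linarith)] at this
  have ht : Tendsto (fun ε : ℝ => (D + ε) * ‖p.2‖ ^ 2) (𝓝[>] 0) (𝓝 ((D + 0) * ‖p.2‖ ^ 2)) := by
    refine Tendsto.mono_left ?_ nhdsWithin_le_nhds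
    exact (Continuous.tendsto (by fun_prop) 0)
  rw [add_zero] at ht
  exact ge_of_tendsto ht (eventually_nhdsWithin_of_forall h)

/-! ### The supremum bound and the Poincaré inequality -/

variable (G)

theorem hasSum_len {L : ℝ} (hL : 0 ≤ L) (h : G.totalLength = ENNReal.ofReal L) :
    HasSum G.len L := by
  have h1 : Summable G.len := by
    have := ENNReal.summable_toReal (f := fun e => ENNReal.ofReal (G.len e))
      (ne_of_eq_of_ne h ENNReal.ofReal_ne_top)
    simpa [ENNReal.toReal_ofReal (G.len_pos _).le] using this
  have h2 : ENNReal.ofReal (∑' e, G.len e) = ENNReal.ofReal L := by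
    rw [ENNReal.ofReal_tsum_of_nonneg (fun e => (G.len_pos e).le) h1, ← h]; rfl
  rw [ENNReal.ofReal_eq_ofReal_iff (tsum_nonneg fun e => (G.len_pos e).le) hL] at h2
  exact h2 ▸ h1.hasSum

variable {G}

theorem norm_edgeL2_sq_le {e : E} {g : G.EdgeL2 e} {B : ℝ}
    (h : ∀ᵐ t ∂volume.restrict (Set.Icc 0 (G.len e)), g t ^ 2 ≤ B) :
    ‖g‖ ^ 2 ≤ G.len e * B := by
  rw [norm_edgeL2_sq]
  refine (integral_mono_ae (Lp.memLp g).integrable_sq (integrable_const B) h).trans_eq ?_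
  simp [Measure.real, (G.len_pos e).le]

theorem norm_sq_le {L B : ℝ} (hL : HasSum G.len L) {w : G.L2}
    (h : ∀ e, ∀ᵐ t ∂volume.restrict (Set.Icc 0 (G.len e)), w e t ^ 2 ≤ B) :
    ‖w‖ ^ 2 ≤ L * B :=
  hasSum_le (fun e => norm_edgeL2_sq_le (h e)) (G.hasSum_norm_sq w) (hL.mul_right B)

theorem norm_const_one_sq (e : E) :
    ‖(Lp.const 2 (volume.restrict (Set.Icc 0 (G.len e))) (1 : ℝ) : G.EdgeL2 e)‖ ^ 2 =
      G.len e := by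
  have h : ∀ᵐ t ∂volume.restrict (Set.Icc 0 (G.len e)),
      (Lp.const 2 (volume.restrict (Set.Icc 0 (G.len e))) (1 : ℝ) : ℝ → ℝ) t ^ 2 = 1 := by
    filter_upwards [Lp.coeFn_const 2 (volume.restrict (Set.Icc 0 (G.len e))) (1 : ℝ)] with t ht
    rw [ht]; simp
  rw [norm_edgeL2_sq, integral_congr_ae h]
  simp [Measure.real, (G.len_pos e).le]

/-- The constant function `1` on a graph of finite length. -/
noncomputable def one (h : Summable G.len) : G.L2 :=
  ⟨fun e => Lp.const 2 (volume.restrict (Set.Icc 0 (G.len e))) 1, by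
    refine memℓp_gen ?_
    simpa [norm_const_one_sq] using h⟩

theorem one_ae (h : Summable G.len) (e : E) :
    (one h e : ℝ → ℝ) =ᵐ[volume.restrict (Set.Icc 0 (G.len e))] fun _ => 1 :=
  Lp.coeFn_const _ _ _

theorem norm_one_sq {L : ℝ} (hL : HasSum G.len L) : ‖one hL.summable‖ ^ 2 = L := by
  refine (G.hasSum_norm_sq _).unique ?_
  have : ∀ e, ‖one hL.summable e‖ ^ 2 = G.len e := fun e => norm_const_one_sq e
  simpa only [this] using hL

theorem IsRep.add {f g : G.Point → ℝ} {p q : G.L2 × G.L2} (hf : G.IsRep f p) (hg : G.IsRep g q) :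
    G.IsRep (f + g) (p + q) := by
  refine ⟨hf.1.add hg.1, fun e => ⟨?_, fun x hx => ?_⟩⟩
  · filter_upwards [(hf.2 e).1, (hg.2 e).1, Lp.coeFn_add (p.1 e) (q.1 e)] with x h1 h2 h3
    exact h3.trans (congrArg₂ (· + ·) h1 h2)
  · have h : (∫ t in 0..x, (p + q).2 e t) = ∫ t in 0..x, (⇑(p.2 e) + ⇑(q.2 e)) t :=
      G.intervalIntegral_congr_edge (Lp.coeFn_add (p.2 e) (q.2 e)) hx
    rw [h]
    simp only [Pi.add_apply]
    rw [intervalIntegral.integral_add (G.intervalIntegrable_edge _ hx)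
      (G.intervalIntegrable_edge _ hx), (hf.2 e).2 x hx, (hg.2 e).2 x hx]
    ring

theorem IsRep.smul {f : G.Point → ℝ} {p : G.L2 × G.L2} (hf : G.IsRep f p) (c : ℝ) :
    G.IsRep (c • f) (c • p) := by
  refine ⟨hf.1.const_smul c, fun e => ⟨?_, fun x hx => ?_⟩⟩
  · filter_upwards [(hf.2 e).1, Lp.coeFn_smul c (p.1 e)] with x h1 h3
    exact h3.trans (congrArg (c • ·) h1)
  · have h : (∫ t in 0..x, (c • p).2 e t) = ∫ t in 0..x, (c • ⇑(p.2 e)) t :=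
      G.intervalIntegral_congr_edge (Lp.coeFn_smul c (p.2 e)) hx
    rw [h]
    simp only [Pi.smul_apply, smul_eq_mul]
    rw [intervalIntegral.integral_const_mul, (hf.2 e).2 x hx]
    ring

theorem IsRep.sub {f g : G.Point → ℝ} {p q : G.L2 × G.L2} (hf : G.IsRep f p) (hg : G.IsRep g q) :
    G.IsRep (f - g) (p - q) := by
  have := hf.add (hg.smul (-1))
  simpa [sub_eq_add_neg] using this

theorem IsRep.norm_smul_one_sub_sq_le {f : G.Point → ℝ} {p : G.L2 × G.L2} (hf : G.IsRep f p)
    {L D : ℝ} (hL : HasSum G.len L) (hD : 0 ≤ D) (hdiam : G.diam ≤ ENNReal.ofReal D)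
    (x : G.Point) : ‖f x • one hL.summable - p.1‖ ^ 2 ≤ L * (D * ‖p.2‖ ^ 2) := by
  refine norm_sq_le hL fun e => ?_
  filter_upwards [Lp.coeFn_sub (f x • one hL.summable e) (p.1 e),
    Lp.coeFn_smul (f x) (one hL.summable e), one_ae hL.summable e, (hf.2 e).1] with t h1 h2 h3 h4
  have h5 : (f x • one hL.summable - p.1) e t = f x - f (G.edgeMap e t) := by
    refine h1.trans ?_
    rw [Pi.sub_apply, h2, Pi.smul_apply, h3, h4]
    simp
  rw [h5]
  exact hf.sq_sub_le_diam hD hdiam _ _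

/-- Functions in `H¹` are bounded by their `H¹`-norm. -/
theorem IsRep.sq_le {f : G.Point → ℝ} {p : G.L2 × G.L2} (hf : G.IsRep f p)
    {L D : ℝ} (hL : HasSum G.len L) (hL0 : 0 < L) (hD : 0 ≤ D)
    (hdiam : G.diam ≤ ENNReal.ofReal D) (x : G.Point) :
    f x ^ 2 ≤ (2 + 2 * L * D) / L * (‖p.1‖ ^ 2 + ‖p.2‖ ^ 2) := by
  have h1 := hf.norm_smul_one_sub_sq_le hL hD hdiam x
  have h2 : ‖f x • one hL.summable‖ ^ 2 = f x ^ 2 * L := by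
    rw [norm_smul, mul_pow, norm_one_sq hL, Real.norm_eq_abs, sq_abs]
  have h3 : ‖f x • one hL.summable‖ ≤ ‖f x • one hL.summable - p.1‖ + ‖p.1‖ := by
    simpa using norm_add_le (f x • one hL.summable - p.1) p.1
  have h4 : ‖f x • one hL.summable‖ ^ 2 ≤
      2 * ‖f x • one hL.summable - p.1‖ ^ 2 + 2 * ‖p.1‖ ^ 2 := by
    refine (pow_le_pow_left₀ (norm_nonneg _) h3 2).trans ?_
    nlinarith [sq_nonneg (‖f x • one hL.summable - p.1‖ - ‖p.1‖)]
  -- So far `L * f x ^ 2 ≤ 2 L D ‖p.2‖^2 + 2 ‖p.1‖^2`; the constant `2 + 2 L D` dominates both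
  -- coefficients.
  rw [div_mul_eq_mul_div, le_div_iff₀ hL0, ← h2]
  have : 0 ≤ L * D * ‖p.1‖ ^ 2 := by positivity
  nlinarith [sq_nonneg ‖p.2‖]

/-- The Poincaré inequality. -/
theorem IsRep.poincare {f : G.Point → ℝ} {p : G.L2 × G.L2} (hf : G.IsRep f p)
    {L D : ℝ} (hL : HasSum G.len L) (hL0 : 0 < L) (hD : 0 ≤ D)
    (hdiam : G.diam ≤ ENNReal.ofReal D) (hmean : inner ℝ (one hL.summable) p.1 = 0) :
    2 * ‖p.1‖ ^ 2 ≤ L * D * ‖p.2‖ ^ 2 := by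
  -- The mean condition removes the cross term of `‖f x • 1 - p.1‖^2`. The surviving `‖p.1‖^2`,
  -- together with the one from integrating over `x`, produces the factor `2`.
  have h1 : ∀ x, f x ^ 2 ≤ (L * (D * ‖p.2‖ ^ 2) - ‖p.1‖ ^ 2) / L := by
    intro x
    have h2 := hf.norm_smul_one_sub_sq_le hL hD hdiam x
    rw [norm_sub_sq_real, inner_smul_left, hmean, norm_smul, mul_pow, norm_one_sq hL,
      Real.norm_eq_abs, sq_abs] at h2
    rw [le_div_iff₀ hL0]
    simp only [mul_zero, sub_zero] at h2
    linarith
  have h2 : ‖p.1‖ ^ 2 ≤ L * ((L * (D * ‖p.2‖ ^ 2) - ‖p.1‖ ^ 2) / L) := by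
    refine norm_sq_le hL fun e => ?_
    filter_upwards [(hf.2 e).1] with t ht
    rw [ht]
    exact h1 _
  rw [mul_div_cancel₀ _ hL0.ne'] at h2
  linarith

/-! ### Closedness of `H¹` and step functions on an edge -/

variable (G)

/-- The restriction of square integrable functions to an edge. -/
noncomputable def edgeRestrict (e : E) : G.L2 →L[ℝ] G.EdgeL2 e :=
  LinearMap.mkContinuous
    { toFun := fun w => w e
      map_add' := fun _ _ => rfl
      map_smul' := fun _ _ => rfl }
    1 fun w => (lp.norm_apply_le_norm (by norm_num) w e).trans_eq (one_mul _).symm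

@[simp]
theorem edgeRestrict_apply (e : E) (w : G.L2) : G.edgeRestrict e w = w e := rfl

/-- The integral is the inner product with the indicator of `(0, x]`. This carries the formula `f x
= f 0 + ∫ f'` to `L²` limits. -/
theorem continuous_intervalIntegral_edge (e : E) {x : ℝ} (hx : x ∈ Set.Icc 0 (G.len e)) :
    Continuous fun g : G.EdgeL2 e => ∫ t in 0..x, g t := by
  have hfin : (volume.restrict (Set.Icc 0 (G.len e))) (Set.Ioc 0 x) ≠ ∞ := measure_ne_top _ _
  have h : (fun g : G.EdgeL2 e => ∫ t in 0..x, g t) =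
      fun g => inner ℝ (indicatorConstLp 2 (measurableSet_Ioc (a := (0 : ℝ)) (b := x)) hfin
        (1 : ℝ)) g := by
    ext g
    rw [L2.inner_indicatorConstLp_one, intervalIntegral.integral_of_le hx.1,
      Measure.restrict_restrict measurableSet_Ioc, Set.inter_eq_left.2]
    exact Set.Ioc_subset_Icc_self.trans (Set.Icc_subset_Icc_right hx.2)
  rw [h]
  fun_prop

variable {G}

/-- By the supremum bound, the representatives of a convergent sequence of pairs are uniformly
Cauchy. Their uniform limit is continuous and represents the limit pair. -/
theorem isClosed_H1 {M : ℝ} (hM : ∀ (f : G.Point → ℝ) (p : G.L2 × G.L2), G.IsRep f p →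
    ∀ x, f x ^ 2 ≤ M * (‖p.1‖ ^ 2 + ‖p.2‖ ^ 2)) : IsClosed (G.H1 : Set (G.L2 × G.L2)) := by
  refine IsSeqClosed.isClosed fun p q hp hpq => ?_
  choose f hf using fun n => G.mem_H1_iff.1 (hp n)
  have hM0 : ∀ m n x, |f m x - f n x| ≤ √(2 * |M|) * dist (p m) (p n) := by
    intro m n x
    refine abs_le_of_sq_le_sq ?_ (by positivity)
    have h1 := hM _ _ ((hf m).sub (hf n)) x
    have h2 : ‖(p m - p n).1‖ ≤ dist (p m) (p n) := by
      rw [dist_eq_norm]; exact norm_fst_le _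
    have h3 : ‖(p m - p n).2‖ ≤ dist (p m) (p n) := by
      rw [dist_eq_norm]; exact norm_snd_le _
    rw [mul_pow, Real.sq_sqrt (by positivity)]
    refine h1.trans ((mul_le_mul_of_nonneg_right (le_abs_self M) (by positivity)).trans ?_)
    have h4 := pow_le_pow_left₀ (norm_nonneg _) h2 2
    have h5 := pow_le_pow_left₀ (norm_nonneg _) h3 2
    nlinarith [abs_nonneg M]
  have hC : ∀ ε > 0, ∃ N, ∀ m ≥ N, ∀ n ≥ N, ∀ x, |f m x - f n x| < ε := by
    intro ε hε
    have hpos : 0 < √(2 * |M|) + 1 := by positivity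
    obtain ⟨N, hN⟩ := Metric.cauchySeq_iff.1 hpq.cauchySeq (ε / (√(2 * |M|) + 1)) (by positivity)
    refine ⟨N, fun m hm n hn x => (hM0 m n x).trans_lt ?_⟩
    have h1 := hN m hm n hn
    rw [lt_div_iff₀ hpos] at h1
    have : 0 ≤ dist (p m) (p n) := dist_nonneg
    nlinarith
  have hunif : UniformCauchySeqOn f atTop Set.univ := by
    rw [Metric.uniformCauchySeqOn_iff]
    intro ε hε
    obtain ⟨N, hN⟩ := hC ε hε
    exact ⟨N, fun m hm n hn x _ => hN m hm n hn x⟩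
  have hlim : ∀ x, ∃ y, Tendsto (fun n => f n x) atTop (𝓝 y) := fun x =>
    cauchySeq_tendsto_of_complete (hunif.cauchySeq (Set.mem_univ x))
  choose g hg using hlim
  have hcont : Continuous g := by
    have := hunif.tendstoUniformlyOn_of_tendsto (fun x _ => hg x)
    rw [tendstoUniformlyOn_univ] at this
    exact this.continuous (Frequently.of_forall fun n => (hf n).1)
  have h1 : Tendsto (fun n => (p n).1) atTop (𝓝 q.1) := (continuous_fst.tendsto q).comp hpq
  have h2 : Tendsto (fun n => (p n).2) atTop (𝓝 q.2) := (continuous_snd.tendsto q).comp hpq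
  refine ⟨g, hcont, fun e => ⟨?_, fun x hx => ?_⟩⟩
  · have h3 : Tendsto (fun n => (p n).1 e) atTop (𝓝 (q.1 e)) :=
      ((G.edgeRestrict e).continuous.tendsto _).comp h1
    -- Almost everywhere convergence along a subsequence suffices, the full sequence already
    -- converging pointwise to `g`.
    obtain ⟨φ, hφ, hae⟩ := (tendstoInMeasure_of_tendsto_Lp h3).exists_seq_tendsto_ae
    have h4 : ∀ᵐ t ∂volume.restrict (Set.Icc 0 (G.len e)), ∀ n, (p n).1 e t = f n (G.edgeMap e t) :=
      ae_all_iff.2 fun n => ((hf n).2 e).1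
    filter_upwards [hae, h4] with t h5 h6
    refine tendsto_nhds_unique h5 ?_
    simp only [h6]
    exact (hg _).comp hφ.tendsto_atTop
  · have h3 : Tendsto (fun n => ∫ t in 0..x, (p n).2 e t) atTop (𝓝 (∫ t in 0..x, q.2 e t)) :=
      ((G.continuous_intervalIntegral_edge e hx).tendsto _).comp
        (((G.edgeRestrict e).continuous.tendsto _).comp h2)
    refine tendsto_nhds_unique (hg _) ?_
    simp only [fun n => ((hf n).2 e).2 x hx]
    exact (hg _).add h3

theorem IsRep.sq_sub_le_abs_mul {f : G.Point → ℝ} {p : G.L2 × G.L2} (hf : G.IsRep f p) {e : E}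
    {a b : ℝ} (ha : a ∈ Set.Icc 0 (G.len e)) (hb : b ∈ Set.Icc 0 (G.len e)) :
    (f (G.edgeMap e a) - f (G.edgeMap e b)) ^ 2 ≤ |a - b| * ‖p.2‖ ^ 2 := by
  refine (hf.sq_sub_le_edge ha hb).trans (mul_le_mul_of_nonneg_left ?_ (abs_nonneg _))
  have h1 : ‖p.2 e‖ ^ 2 ≤ ‖p.2‖ ^ 2 :=
    pow_le_pow_left₀ (norm_nonneg _) (lp.norm_apply_le_norm (by norm_num) _ _) 2
  refine le_trans ?_ h1
  rw [norm_edgeL2_sq]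
  exact setIntegral_mono_set (Lp.memLp (p.2 e)).integrable_sq (ae_of_all _ fun t => sq_nonneg _)
    (Set.uIoc_subset_uIcc.trans (Set.uIcc_subset_Icc ha hb)).eventuallyLE

variable (G) in
/-- The restrictions of `H¹`-functions to an edge are approximated by step functions. -/
theorem exists_finiteDimensional_approx (e : E) {n : ℕ} (hn : 0 < n) :
    ∃ V : Submodule ℝ (G.EdgeL2 e), FiniteDimensional ℝ V ∧
      ∀ (f : G.Point → ℝ) (p : G.L2 × G.L2), G.IsRep f p →
        ∃ v ∈ V, ‖p.1 e - v‖ ^ 2 ≤ G.len e * (G.len e / n * ‖p.2‖ ^ 2) := by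
  have hℓ := G.len_pos e
  have hn' : (0 : ℝ) < n := Nat.cast_pos.2 hn
  -- The cell of length `G.len e / n` that contains `t`. The right endpoint `t = G.len e` lies in
  -- cell `n`, hence the `n + 1` indicators below.
  let κ : ℝ → ℕ := fun t => ⌊t * n / G.len e⌋₊
  have hκ : Measurable κ := Nat.measurable_floor.comp (by fun_prop)
  have hS : ∀ k, MeasurableSet {t | κ t = k} := fun k => hκ (measurableSet_singleton k)
  let ind : ℕ → G.EdgeL2 e := fun k => indicatorConstLp 2 (hS k) (measure_ne_top _ _) (1 : ℝ)
  refine ⟨Submodule.span ℝ (ind '' (Finset.range (n + 1))),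
    FiniteDimensional.span_of_finite ℝ ((Finset.finite_toSet _).image _), fun f p hf => ?_⟩
  let a : ℕ → ℝ := fun k => k * (G.len e / n)
  have ha : ∀ k ≤ n, a k ∈ Set.Icc 0 (G.len e) := by
    intro k hk
    have : (k : ℝ) ≤ n := Nat.cast_le.2 hk
    refine ⟨by positivity, ?_⟩
    simp only [a]
    rw [← mul_div_assoc, div_le_iff₀ hn', mul_comm]
    exact mul_le_mul_of_nonneg_left this hℓ.le
  refine ⟨∑ k ∈ Finset.range (n + 1), f (G.edgeMap e (a k)) • ind k,
    Submodule.sum_mem _ fun k hk => Submodule.smul_mem _ _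
      (Submodule.subset_span ⟨k, hk, rfl⟩), norm_edgeL2_sq_le ?_⟩
  have h1 : ∀ᵐ t ∂volume.restrict (Set.Icc 0 (G.len e)), ∀ k,
      (f (G.edgeMap e (a k)) • ind k : G.EdgeL2 e) t =
        if κ t = k then f (G.edgeMap e (a k)) else 0 := by
    rw [ae_all_iff]
    intro k
    filter_upwards [Lp.coeFn_smul (f (G.edgeMap e (a k))) (ind k),
      indicatorConstLp_coeFn (p := 2) (hs := hS k) (hμs := measure_ne_top
        (volume.restrict (Set.Icc 0 (G.len e))) _) (c := (1 : ℝ))] with t h2 h3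
    rw [h2, Pi.smul_apply, h3]
    simp [Set.indicator_apply]
  have h2 : ((∑ k ∈ Finset.range (n + 1), f (G.edgeMap e (a k)) • ind k : G.EdgeL2 e) : ℝ → ℝ)
      =ᵐ[volume.restrict (Set.Icc 0 (G.len e))]
      fun t => ∑ k ∈ Finset.range (n + 1), (f (G.edgeMap e (a k)) • ind k : G.EdgeL2 e) t :=
    (Lp.coeFn_finsetSum _ _).trans (ae_of_all _ fun t => Finset.sum_apply _ _ _)
  filter_upwards [h1, h2, Lp.coeFn_sub (p.1 e) (∑ k ∈ Finset.range (n + 1),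
    f (G.edgeMap e (a k)) • ind k), (hf.2 e).1, ae_restrict_mem measurableSet_Icc]
    with t h1 h2 h3 h4 ht
  have hpos : 0 ≤ t * n / G.len e := by have := ht.1; positivity
  have hκn : κ t ≤ n := by
    refine Nat.floor_le_of_le ?_
    rw [div_le_iff₀ hℓ, mul_comm]
    exact mul_le_mul_of_nonneg_left ht.2 hn'.le
  have hdist : |t - a (κ t)| ≤ G.len e / n := by
    have e1 : t = t * n / G.len e * (G.len e / n) := by field_simp
    have e2 : t - a (κ t) = (t * n / G.len e - κ t) * (G.len e / n) := by
      rw [sub_mul, ← e1]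
    rw [e2, abs_mul, abs_of_nonneg (by positivity : 0 ≤ G.len e / n)]
    refine mul_le_of_le_one_left (by positivity) ?_
    rw [abs_le]
    constructor
    · linarith [Nat.floor_le hpos]
    · linarith [Nat.lt_floor_add_one (t * n / G.len e)]
  rw [h3, Pi.sub_apply, h4, h2]
  simp only [h1]
  rw [Finset.sum_ite_eq, if_pos (Finset.mem_range.2 (Nat.lt_succ_of_le hκn))]
  exact (hf.sq_sub_le_abs_mul ht (ha _ hκn)).trans
    (mul_le_mul_of_nonneg_right hdist (sq_nonneg _))

end MetricGraph

/-! ### Compactness of the embedding of `H¹` into `L²` -/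

theorem isCompactOperator_comp {X Y Z : Type*} [NormedAddCommGroup X] [NormedSpace ℝ X]
    [NormedAddCommGroup Y] [NormedSpace ℝ Y] [NormedAddCommGroup Z] [NormedSpace ℝ Z]
    (g : Y →L[ℝ] Z) {f : X →L[ℝ] Y} (hf : IsCompactOperator f) :
    IsCompactOperator (g.comp f) :=
  hf.clm_comp g

theorem isCompactOperator_sum {ι X Y : Type*} [NormedAddCommGroup X] [NormedSpace ℝ X]
    [NormedAddCommGroup Y] [NormedSpace ℝ Y] (s : Finset ι) {F : ι → X →L[ℝ] Y}
    (hF : ∀ i, IsCompactOperator (F i)) : IsCompactOperator (∑ i ∈ s, F i : X →L[ℝ] Y) :=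
  Submodule.sum_mem (compactOperator (RingHom.id ℝ) X Y) fun i _ => hF i

theorem isCompactOperator_of_norm_sub_le {ι X Y : Type*} [NormedAddCommGroup X]
    [NormedSpace ℝ X] [NormedAddCommGroup Y] [NormedSpace ℝ Y] [CompleteSpace Y] {l : Filter ι}
    [l.NeBot] {F : ι → X →L[ℝ] Y} {f : X →L[ℝ] Y} (hF : ∀ i, IsCompactOperator (F i)) {r : ι → ℝ}
    (hr : ∀ i, 0 ≤ r i) (h : ∀ i x, ‖F i x - f x‖ ≤ r i * ‖x‖) (hr0 : Tendsto r l (𝓝 0)) :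
    IsCompactOperator f :=
  isCompactOperator_of_tendsto (tendsto_iff_norm_sub_tendsto_zero.2
    (squeeze_zero (fun i => norm_nonneg (F i - f))
      (fun i => (F i - f).opNorm_le_bound (hr i) (h i)) hr0)) (Eventually.of_forall hF)

/-- An operator into a Hilbert space whose values are approximated by finite-dimensional subspaces
is compact. -/
theorem isCompactOperator_of_forall_finiteDimensional {X H : Type*} [NormedAddCommGroup X]
    [NormedSpace ℝ X] [NormedAddCommGroup H] [InnerProductSpace ℝ H] [CompleteSpace H]
    (T : X →L[ℝ] H) (h : ∀ ε > 0, ∃ V : Submodule ℝ H, FiniteDimensional ℝ V ∧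
      ∀ x, ∃ v ∈ V, ‖T x - v‖ ≤ ε * ‖x‖) : IsCompactOperator T := by
  have hcl : IsClosed {f : X →L[ℝ] H | IsCompactOperator f} := isClosed_setOfPred_isCompactOperator
  rw [← Set.mem_ofPred_eq (p := fun f : X →L[ℝ] H => IsCompactOperator f), ← hcl.closure_eq,
    Metric.mem_closure_iff]
  intro ε hε
  obtain ⟨V, hV, h⟩ := h (ε / 2) (by positivity)
  -- The orthogonal projection onto `V` is at least as close to `T x` as the given `v`, and it makes
  -- the approximant linear and of finite rank.
  refine ⟨V.starProjection.comp T, ?_, ?_⟩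
  · have h1 : IsCompactOperator (V.orthogonalProjectionOnto.comp T) :=
      isCompactOperator_of_locallyCompactSpace_dom _
    exact h1.clm_comp V.subtypeL
  · rw [dist_eq_norm]
    refine (ContinuousLinearMap.opNorm_le_bound _ (by positivity : 0 ≤ ε / 2) fun x => ?_).trans_lt
      (half_lt_self hε)
    obtain ⟨v, hv, hv'⟩ := h x
    refine le_trans ?_ hv'
    change ‖T x - V.starProjection (T x)‖ ≤ _
    rw [Submodule.starProjection_minimal]
    exact ciInf_le ⟨0, by rintro _ ⟨y, rfl⟩; exact norm_nonneg _⟩ (⟨v, hv⟩ : V)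

namespace MetricGraph

variable {E : Type*} (G : MetricGraph E)

/-- The Sobolev space `H¹(G)` with its inner product. -/
noncomputable def sobolev : Submodule ℝ (WithLp 2 (G.L2 × G.L2)) :=
  G.H1.comap (WithLp.linearEquiv 2 ℝ (G.L2 × G.L2)).toLinearMap

/-- The embedding of `H¹(G)` into `L²(G)`. -/
noncomputable def embedding : G.sobolev →L[ℝ] G.L2 :=
  (WithLp.fstL 2 ℝ G.L2 G.L2).comp G.sobolev.subtypeL

theorem mem_sobolev {p : WithLp 2 (G.L2 × G.L2)} :
    p ∈ G.sobolev ↔ ∃ f, G.IsRep f (p.fst, p.snd) := Iff.rfl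

@[simp]
theorem embedding_apply (p : G.sobolev) : G.embedding p = p.1.fst := rfl

theorem norm_sobolev_sq (p : G.sobolev) : ‖p‖ ^ 2 = ‖p.1.fst‖ ^ 2 + ‖p.1.snd‖ ^ 2 :=
  WithLp.prod_norm_sq_eq_of_L2 p.1

variable {G}

theorem isClosed_sobolev {M : ℝ} (hM : ∀ (f : G.Point → ℝ) (p : G.L2 × G.L2), G.IsRep f p →
    ∀ x, f x ^ 2 ≤ M * (‖p.1‖ ^ 2 + ‖p.2‖ ^ 2)) :
    IsClosed (G.sobolev : Set (WithLp 2 (G.L2 × G.L2))) :=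
  (isClosed_H1 hM).preimage (WithLp.prodContinuousLinearEquiv 2 ℝ G.L2 G.L2).continuous

variable (G) in
theorem isCompactOperator_edgeRestrict_comp_embedding (e : E) :
    IsCompactOperator ((G.edgeRestrict e).comp G.embedding) := by
  refine isCompactOperator_of_forall_finiteDimensional _ fun ε hε => ?_
  have hℓ := G.len_pos e
  obtain ⟨n, hn⟩ := exists_nat_gt (G.len e * G.len e / ε ^ 2)
  have hn0 : (0 : ℝ) < n := lt_of_le_of_lt (by positivity) hn
  obtain ⟨V, hV, h⟩ := G.exists_finiteDimensional_approx e (Nat.cast_pos.1 hn0)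
  refine ⟨V, hV, fun p => ?_⟩
  obtain ⟨f, hf⟩ := G.mem_sobolev.1 p.2
  obtain ⟨v, hv, hv'⟩ := h f _ hf
  refine ⟨v, hv, ?_⟩
  refine le_of_sq_le_sq ?_ (by positivity)
  refine hv'.trans ?_
  have h1 : ‖p.1.snd‖ ^ 2 ≤ ‖p‖ ^ 2 := by
    rw [norm_sobolev_sq]; linarith [sq_nonneg ‖p.1.fst‖]
  have h2 : G.len e * (G.len e / n) ≤ ε ^ 2 := by
    rw [div_lt_iff₀ (by positivity)] at hn
    rw [← mul_div_assoc, div_le_iff₀ hn0]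
    linarith
  rw [mul_pow, ← mul_assoc]
  exact mul_le_mul h2 h1 (sq_nonneg _) (sq_nonneg _)

/-- Truncation to a finite set `s` of edges is compact. By the supremum bound each omitted edge
costs at most `len e * M * ‖p‖^2`, so the squared error is controlled by the total length outside
`s`, which tends to `0`. -/
theorem isCompactOperator_embedding {L : ℝ} (hL : HasSum G.len L) {M : ℝ} (hM0 : 0 ≤ M)
    (hM : ∀ (f : G.Point → ℝ) (p : G.L2 × G.L2), G.IsRep f p →
      ∀ x, f x ^ 2 ≤ M * (‖p.1‖ ^ 2 + ‖p.2‖ ^ 2)) : IsCompactOperator G.embedding := by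
  classical
  let T : Finset E → G.sobolev →L[ℝ] G.L2 := fun s => ∑ e ∈ s,
    (lp.singleContinuousLinearMap ℝ (fun e => G.EdgeL2 e) 2 e).comp
      ((G.edgeRestrict e).comp G.embedding)
  have hT : ∀ s, IsCompactOperator (T s) := fun s => isCompactOperator_sum s fun e =>
    isCompactOperator_comp (lp.singleContinuousLinearMap ℝ (fun e => G.EdgeL2 e) 2 e)
      (G.isCompactOperator_edgeRestrict_comp_embedding e)
  have hbound : ∀ s p, ‖T s p - G.embedding p‖ ≤ √((L - ∑ e ∈ s, G.len e) * M) * ‖p‖ := by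
    intro s p
    obtain ⟨f, hf⟩ := G.mem_sobolev.1 p.2
    have h1 : T s p - G.embedding p = ∑ e ∈ s, lp.single 2 e (p.1.fst e) - p.1.fst := by
      simp [T]
    have h2 : ‖∑ e ∈ s, lp.single 2 e (p.1.fst e) - p.1.fst‖ ^ 2 =
        ‖p.1.fst‖ ^ 2 - ∑ e ∈ s, ‖p.1.fst e‖ ^ 2 := by
      have := lp.norm_compl_sum_single (p := 2) (by norm_num) p.1.fst s
      rw [norm_sub_rev]
      simpa using this
    have h3 : ∀ e, ‖p.1.fst e‖ ^ 2 ≤ G.len e * (M * ‖p‖ ^ 2) := fun e => by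
      refine norm_edgeL2_sq_le ?_
      filter_upwards [(hf.2 e).1] with t ht
      rw [ht, norm_sobolev_sq]
      exact hM f _ hf _
    have h4 : ‖p.1.fst‖ ^ 2 - ∑ e ∈ s, ‖p.1.fst e‖ ^ 2 ≤
        (L - ∑ e ∈ s, G.len e) * (M * ‖p‖ ^ 2) := by
      refine hasSum_le (L := .unconditional _) (f := fun e : {e // e ∉ s} => ‖p.1.fst e‖ ^ 2)
        (g := fun e : {e // e ∉ s} => G.len e * (M * ‖p‖ ^ 2)) (fun e => h3 e) ?_ ?_
      · rw [s.hasSum_compl_iff (f := fun e => ‖p.1.fst e‖ ^ 2), sub_add_cancel]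
        exact G.hasSum_norm_sq _
      · refine HasSum.mul_right _ ?_
        rw [s.hasSum_compl_iff, sub_add_cancel]
        exact hL
    have h5 : 0 ≤ L - ∑ e ∈ s, G.len e :=
      sub_nonneg.2 (sum_le_hasSum s (fun e _ => (G.len_pos e).le) hL)
    rw [h1]
    refine le_of_sq_le_sq ?_ (by positivity)
    rw [h2, mul_pow, Real.sq_sqrt (by positivity), mul_assoc]
    exact h4
  refine isCompactOperator_of_norm_sub_le (l := atTop) hT (fun s => Real.sqrt_nonneg _) hbound ?_
  have h1 : Tendsto (fun s => √((L - ∑ e ∈ s, G.len e) * M)) atTop (𝓝 √((L - L) * M)) :=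
    (Real.continuous_sqrt.tendsto _).comp ((tendsto_const_nhds.sub hL).mul_const M)
  simpa using h1

end MetricGraph

/-! ### Spectral theory of compact symmetric operators -/

theorem exists_equiv_nat_monotone {ι : Type*} [Infinite ι] (f : ι → ℝ)
    (hf : ∀ c, {i | f i ≤ c}.Finite) : ∃ e : ℕ ≃ ι, Monotone (f ∘ e) := by
  classical
  have : Countable ι := by
    have h : (Set.univ : Set ι) = ⋃ n : ℕ, {i | f i ≤ n} := by
      ext i
      simpa using exists_nat_ge (f i)
    rw [← Set.countable_univ_iff, h]
    exact Set.countable_iUnion fun n => (hf n).countable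
  obtain ⟨g, hg⟩ := exists_injective_nat ι
  -- Ties of `f` are broken by an injection into `ℕ`. In this total order every element has finitely
  -- many predecessors; their number `r` is injective, and its infinite range is enumerated in
  -- increasing order.
  let k : ι → ℝ ×ₗ ℕ := fun i => toLex (f i, g i)
  have hk : Function.Injective k := fun i j h => by
    have : (f i, g i) = (f j, g j) := toLex.injective h
    exact hg (Prod.ext_iff.1 this).2
  have hle : ∀ i j, k i ≤ k j → f i ≤ f j := fun i j h => by
    rcases Prod.Lex.le_iff.1 h with h | h
    · exact h.le
    · exact h.1.le
  have hfin : ∀ i, {j | k j < k i}.Finite := fun i =>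
    (hf (f i)).subset fun j hj => hle j i (le_of_lt hj)
  let r : ι → ℕ := fun i => {j | k j < k i}.ncard
  have hr : ∀ i j, k i < k j → r i < r j := fun i j h =>
    Set.ncard_lt_ncard ⟨fun l (hl : k l < k i) => hl.trans h,
      fun hsub => lt_irrefl (k i) (hsub h)⟩ (hfin j)
  have hinj : Function.Injective r := fun i j h => by
    rcases lt_trichotomy (k i) (k j) with h1 | h1 | h1
    · exact absurd h (hr i j h1).ne
    · exact hk h1
    · exact absurd h (hr j i h1).ne'
  have : Infinite (Set.range r) := (Set.infinite_range_of_injective hinj).to_subtype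
  refine ⟨(Nat.Subtype.orderIsoOfNat (Set.range r)).toEquiv.trans
    (Equiv.ofInjective r hinj).symm, fun m n hmn => ?_⟩
  refine hle _ _ (not_lt.1 fun hlt => ?_)
  have h1 := hr _ _ hlt
  have h2 : ∀ s : Set.range r, r ((Equiv.ofInjective r hinj).symm s) = s := fun s =>
    Equiv.apply_ofInjective_symm hinj s
  simp only [Equiv.trans_apply, h2] at h1
  exact absurd ((Nat.Subtype.orderIsoOfNat (Set.range r)).monotone hmn) (not_le.2 h1)

section

universe u

variable {H : Type u} [NormedAddCommGroup H] [InnerProductSpace ℝ H]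

open Module.End

/-- The eigenvectors of a compact symmetric operator contain a Hilbert basis. -/
theorem exists_hilbertBasis_eigenvectors [CompleteSpace H] (K : H →L[ℝ] H) (hK : IsCompactOperator K)
    (hsymm : (K : H →ₗ[ℝ] H).IsSymmetric) :
    ∃ (ι : Type u) (b : HilbertBasis ι ℝ H) (c : ι → ℝ), ∀ i, K (b i) = c i • b i := by
  let V : ℝ → Submodule ℝ H := fun c => eigenspace (K : Module.End ℝ H) c
  have hV : ∀ c, IsClosed (V c : Set H) := fun c => by
    have : (V c : Set H) = {x | K x = c • x} := by
      ext x
      exact mem_eigenspace_iff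
    rw [this]
    exact isClosed_eq K.continuous (continuous_const_smul c)
  have : ∀ c, CompleteSpace (V c) := fun c => (hV c).completeSpace_coe
  -- Here `c` runs over all reals; if it is not an eigenvalue, `V c` is zero and contributes no
  -- basis vector.
  choose w b hb using fun c => exists_hilbertBasis ℝ (V c)
  have horth : OrthogonalFamily ℝ (fun c => V c) fun c => (V c).subtypeₗᵢ :=
    hsymm.orthogonalFamily_eigenspaces
  have hon := horth.orthonormal_sigma_orthonormal (fun c => (b c).orthonormal)
  have hbot : (Submodule.span ℝ (Set.range fun a : Σ c, w c =>
      (V a.1).subtypeₗᵢ (b a.1 a.2)))ᗮ = ⊥ := by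
    rw [eq_bot_iff, ← ContinuousLinearMap.orthogonalComplement_iSup_eigenspaces_eq_bot hK hsymm,
      ← Submodule.iInf_orthogonal]
    refine le_iInf fun c y hy => ?_
    rw [Submodule.mem_orthogonal']
    intro x hx
    have hs := (b c).hasSum_repr ⟨x, hx⟩
    have hs' := hs.mapL ((innerSL ℝ y).comp (V c).subtypeL)
    refine hs'.unique ?_
    convert hasSum_zero with i
    simp only [map_smul, smul_eq_mul]
    have : ((innerSL ℝ y).comp (V c).subtypeL) (b c i) = 0 := by
      have := (Submodule.mem_orthogonal' _ _).1 hy ((V c).subtypeₗᵢ (b c i))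
        (Submodule.subset_span ⟨⟨c, i⟩, rfl⟩)
      exact this
    rw [this, mul_zero]
  refine ⟨_, HilbertBasis.mkOfOrthogonalEqBot hon hbot, fun a => a.1, fun a => ?_⟩
  rw [HilbertBasis.coe_mkOfOrthogonalEqBot]
  exact mem_eigenspace_iff.1 (b a.1 a.2).2

/-- Two distinct such eigenvectors have images at squared distance `c i ^ 2 + c j ^ 2 ≥ ε ^ 2`, so
infinitely many would give a bounded sequence whose images have no Cauchy subsequence. -/
theorem finite_setOf_le_eigenvalue {K : H →L[ℝ] H} (hK : IsCompactOperator K) {ι : Type*}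
    {b : ι → H} (hb : Orthonormal ℝ b) {c : ι → ℝ} (hc : ∀ i, K (b i) = c i • b i) {ε : ℝ}
    (hε : 0 < ε) : {i | ε ≤ c i}.Finite := by
  by_contra hinf
  have : Infinite {i | ε ≤ c i} := Set.infinite_coe_iff.2 hinf
  let s : ℕ ↪ {i | ε ≤ c i} := Infinite.natEmbedding _
  obtain ⟨C, hC, hsub⟩ := hK.image_closedBall_subset_compact (f := (K : H →ₗ[ℝ] H)) 1
  have hmem : ∀ n, K (b (s n)) ∈ C := fun n => hsub ⟨_, by simp [hb.1], rfl⟩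
  obtain ⟨x, -, φ, hφ, hx⟩ := hC.tendsto_subseq hmem
  obtain ⟨N, hN⟩ := Metric.cauchySeq_iff.1 hx.cauchySeq ε hε
  have h1 := hN N le_rfl (N + 1) (Nat.le_succ N)
  have hne : (s (φ N) : ι) ≠ s (φ (N + 1)) := fun h =>
    (hφ (Nat.lt_succ_self N)).ne (s.injective (Subtype.ext h))
  simp only [Function.comp_apply, hc, dist_eq_norm] at h1
  have h2 : ‖c (s (φ N)) • b (s (φ N)) - c (s (φ (N + 1))) • b (s (φ (N + 1)))‖ ^ 2 =
      c (s (φ N)) ^ 2 + c (s (φ (N + 1))) ^ 2 := by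
    rw [norm_sub_sq_real, inner_smul_left, inner_smul_right, hb.2 hne]
    simp [norm_smul, hb.1]
  have h3 : ε ≤ c (s (φ N)) := (s (φ N)).2
  have h4 := pow_lt_pow_left₀ h1 (norm_nonneg _) two_ne_zero
  rw [h2] at h4
  nlinarith [sq_nonneg (c (s (φ (N + 1))))]

theorem exists_hilbertBasis_nat_of_isCompactOperator [CompleteSpace H]
    (hinf : ¬ FiniteDimensional ℝ H)
    (K : H →L[ℝ] H) (hK : IsCompactOperator K) (hsymm : (K : H →ₗ[ℝ] H).IsSymmetric)
    (hpos : ∀ x, x ≠ 0 → 0 < inner ℝ (K x) x) :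
    ∃ (b : HilbertBasis ℕ ℝ H) (c : ℕ → ℝ), (∀ i, K (b i) = c i • b i) ∧ (∀ i, 0 < c i) ∧
      Monotone (fun i => (c i)⁻¹) ∧ Tendsto (fun i => (c i)⁻¹) atTop atTop := by
  obtain ⟨ι, b, c, hc⟩ := exists_hilbertBasis_eigenvectors K hK hsymm
  have hc0 : ∀ i, 0 < c i := fun i => by
    have h := hpos (b i) (b.orthonormal.ne_zero i)
    rw [hc, inner_smul_left, real_inner_self_eq_norm_sq, b.orthonormal.1] at h
    simpa using h
  have hfin : ∀ r, {i | (c i)⁻¹ ≤ r}.Finite := fun r => by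
    rcases le_or_gt r 0 with hr | hr
    · refine Set.finite_empty.subset fun i (hi : _ ≤ r) => ?_
      have := inv_pos.2 (hc0 i)
      linarith
    · refine (finite_setOf_le_eigenvalue hK b.orthonormal hc (inv_pos.2 hr)).subset fun i hi => ?_
      exact (inv_le_comm₀ hr (hc0 i)).2 hi
  have : Infinite ι := by
    rw [← not_finite_iff_infinite]
    intro hι
    have := Fintype.ofFinite ι
    exact hinf (b.toOrthonormalBasis.toBasis.finiteDimensional_of_finite)
  obtain ⟨e, he⟩ := exists_equiv_nat_monotone (fun i => (c i)⁻¹) hfin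
  have hon : Orthonormal ℝ (b ∘ e) := b.orthonormal.comp e e.injective
  have hbot : (Submodule.span ℝ (Set.range (b ∘ e)))ᗮ = ⊥ := by
    rw [EquivLike.range_comp, ← Submodule.orthogonal_closure, b.dense_span, Submodule.top_orthogonal_eq_bot]
  refine ⟨HilbertBasis.mkOfOrthogonalEqBot hon hbot, c ∘ e, fun i => ?_, fun i => hc0 _, he, ?_⟩
  · rw [HilbertBasis.coe_mkOfOrthogonalEqBot]
    exact hc _
  · rw [← Nat.cofinite_eq_atTop, tendsto_atTop]
    intro r
    rw [eventually_cofinite]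
    refine ((hfin r).preimage e.injective.injOn).subset fun n hn => ?_
    exact (not_le.1 hn).le

open ContinuousLinearMap in
/-- If `J` is compact with dense range, the eigenvectors of `J J*` form a Hilbert basis. -/
theorem exists_hilbertBasis_nat_of_isCompactOperator_adjoint [CompleteSpace H] {X : Type*}
    [NormedAddCommGroup X] [InnerProductSpace ℝ X] [CompleteSpace X]
    (hinf : ¬ FiniteDimensional ℝ H) (J : X →L[ℝ] H) (hJ : IsCompactOperator J)
    (hdense : ∀ x, (∀ p, inner ℝ x (J p) = 0) → x = 0) :
    ∃ (b : HilbertBasis ℕ ℝ H) (c : ℕ → ℝ), (∀ i, J (adjoint J (b i)) = c i • b i) ∧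
      (∀ i, 0 < c i) ∧ Monotone (fun i => (c i)⁻¹) ∧ Tendsto (fun i => (c i)⁻¹) atTop atTop := by
  have hinner : ∀ x y, inner ℝ ((J.comp (adjoint J)) x) y = inner ℝ (adjoint J x) (adjoint J y) :=
    fun x y => (adjoint_inner_right J (adjoint J x) y).symm
  refine exists_hilbertBasis_nat_of_isCompactOperator hinf (J.comp (adjoint J)) (hJ.comp_clm _)
    (fun x y => ?_) fun x hx => ?_
  · change inner ℝ ((J.comp (adjoint J)) x) y = inner ℝ x ((J.comp (adjoint J)) y)
    rw [hinner, ← real_inner_comm, ← hinner, real_inner_comm]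
  · rw [hinner]
    -- The kernel of `J*` is the orthogonal complement of the range of `J`.
    refine real_inner_self_pos.2 fun h0 => hx (hdense x fun p => ?_)
    rw [← adjoint_inner_left, h0, inner_zero_left]

end

/-! ### Eigenvalues of the Neumann extension -/

namespace MetricGraph

variable {E : Type*} (G : MetricGraph E)

/-- The indicators of the disjoint intervals `(ℓ/(n+2), ℓ/(n+1)]`, with `ℓ` the edge length, are
nonzero and orthogonal. This is what allows an eigenbasis indexed by `ℕ`. -/
theorem not_finiteDimensional_edgeL2 (e : E) : ¬ FiniteDimensional ℝ (G.EdgeL2 e) := by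
  intro hfd
  have hℓ := G.len_pos e
  let a : ℕ → ℝ := fun n => G.len e / (n + 1)
  have ha : StrictAnti a := fun m n hmn => by
    have : (m : ℝ) < n := Nat.cast_lt.2 hmn
    exact div_lt_div_of_pos_left hℓ (by positivity) (by linarith)
  let S : ℕ → Set ℝ := fun n => Set.Ioc (a (n + 1)) (a n)
  have hS : ∀ n, MeasurableSet (S n) := fun n => measurableSet_Ioc
  have hsub : ∀ n, S n ⊆ Set.Icc 0 (G.len e) := fun n t ht => by
    refine ⟨le_trans (by positivity) ht.1.le, ht.2.trans ?_⟩
    have := ha.antitone (Nat.zero_le n)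
    simpa [a] using this
  let v : ℕ → G.EdgeL2 e := fun n => indicatorConstLp 2 (hS n) (measure_ne_top _ _) (1 : ℝ)
  have hdisj : Pairwise fun m n => Disjoint (S m) (S n) := by
    have := ha.antitone.pairwise_disjoint_on_Ioc_succ
    exact this
  have hinner : ∀ m n, inner ℝ (v m) (v n) =
      (volume.restrict (Set.Icc 0 (G.len e))).real (S m ∩ S n) := fun m n => by
    rw [L2.inner_indicatorConstLp_one]
    have h1 : ∀ᵐ t ∂(volume.restrict (Set.Icc 0 (G.len e))).restrict (S m),
        v n t = (S n).indicator (fun _ => (1 : ℝ)) t :=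
      ae_restrict_of_ae indicatorConstLp_coeFn
    rw [integral_congr_ae h1, setIntegral_indicator (hS n)]
    simp
  have hli : LinearIndependent ℝ v := by
    refine linearIndependent_of_ne_zero_of_inner_eq_zero (𝕜 := ℝ) (fun n h0 => ?_) fun m n hmn => ?_
    · have h1 := hinner n n
      rw [h0, inner_zero_left, Set.inter_self, measureReal_restrict_apply (hS n),
        Set.inter_eq_left.2 (hsub n)] at h1
      have h2 : a (n + 1) < a n := ha (Nat.lt_succ_self n)
      simp only [S, Real.volume_real_Ioc_of_le h2.le] at h1
      linarith
    · refine (hinner m n).trans ?_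
      rw [(hdisj hmn).inter_eq]
      simp
  exact Set.infinite_univ.not_finite (Set.finite_univ_iff.2 hli.finite)

theorem not_finiteDimensional_L2 [Nonempty E] : ¬ FiniteDimensional ℝ G.L2 := by
  classical
  intro hfd
  obtain ⟨e⟩ := ‹Nonempty E›
  refine G.not_finiteDimensional_edgeL2 e (FiniteDimensional.of_injective
    (lp.singleContinuousLinearMap ℝ (fun e => G.EdgeL2 e) 2 e).toLinearMap fun g h hgh => ?_)
  exact (lp.isometry_single (E := fun e => G.EdgeL2 e) (p := 2) e).injective hgh

theorem mem_neumannGraph_iff {u w : G.L2} : (u, w) ∈ G.neumannGraph ↔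
    ∃ h : u ∈ G.neumannLaplacian.domain, G.neumannLaplacian ⟨u, h⟩ = w := by
  have h1 : G.neumannLaplacian.graph = G.neumannGraph :=
    Submodule.toLinearPMap_graph_eq _ G.neumannGraph_single_valued
  rw [← h1, LinearPMap.mem_graph_iff]
  constructor
  · rintro ⟨⟨y, hy⟩, rfl, h⟩
    exact ⟨hy, h⟩
  · rintro ⟨h, h'⟩
    exact ⟨⟨u, h⟩, rfl, h'⟩

theorem inner_sobolev (p q : G.sobolev) :
    inner ℝ p q = inner ℝ p.1.fst q.1.fst + inner ℝ p.1.snd q.1.snd :=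
  WithLp.prod_inner_apply p.1 q.1

open ContinuousLinearMap in
/-- The eigenvectors of the squared embedding of `H¹(G)` are those of the Neumann extension. -/
theorem smul_mem_neumannGraph [CompleteSpace G.sobolev] {b : G.L2} {c : ℝ} (hc : c ≠ 0)
    (hb : G.embedding (adjoint G.embedding b) = c • b) : (b, (c⁻¹ - 1) • b) ∈ G.neumannGraph := by
  set p := adjoint G.embedding b with hp
  -- Since `p = J* b` has first component `c • b`, the identity `⟪p, q⟫ = ⟪b, J q⟫` reads `c ⟪b, v⟫
  -- + ⟪p', v'⟫ = ⟪b, v⟫`, the weak equation for `c • b`. Dividing by `c` gives the claim.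
  have h1 : (c • b, (1 - c) • b) ∈ G.neumannGraph := by
    refine ⟨p.1.snd, ?_, fun v v' hv => ?_⟩
    · rw [← hb]; exact p.2
    · let q : G.sobolev := ⟨WithLp.toLp 2 (v, v'), hv⟩
      have h2 : inner ℝ p q = inner ℝ b (G.embedding q) := adjoint_inner_left _ _ _
      have h3 : inner ℝ p q = inner ℝ (c • b) v + inner ℝ p.1.snd v' := by
        rw [inner_sobolev, ← hb]; rfl
      have h4 : inner ℝ b (G.embedding q) = inner ℝ b v := rfl
      rw [h3, h4, inner_smul_left] at h2
      rw [inner_smul_left]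
      simp only [RCLike.conj_to_real] at h2 ⊢
      linarith
  have h2 := G.neumannGraph.smul_mem c⁻¹ h1
  simp only [Prod.smul_mk, smul_smul, inv_mul_cancel₀ hc, one_smul, mul_sub, mul_one] at h2
  exact h2

variable {G}

theorem exists_isEigenvalueSequence [Nonempty E] {L : ℝ} (hL : HasSum G.len L) {M : ℝ}
    (hM0 : 0 ≤ M) (hM : ∀ (f : G.Point → ℝ) (p : G.L2 × G.L2), G.IsRep f p →
      ∀ x, f x ^ 2 ≤ M * (‖p.1‖ ^ 2 + ‖p.2‖ ^ 2)) :
    ∃ μ : ℕ → ℝ, IsEigenvalueSequence G.neumannLaplacian μ := by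
  have : CompleteSpace G.sobolev := (isClosed_sobolev hM).completeSpace_coe
  obtain ⟨b, c, hc, hc0, hmono, htop⟩ :=
    exists_hilbertBasis_nat_of_isCompactOperator_adjoint G.not_finiteDimensional_L2 G.embedding
      (isCompactOperator_embedding hL hM0 hM) fun x hx =>
        G.eq_zero_of_orthogonal_H1 x fun v v' hv => hx ⟨WithLp.toLp 2 (v, v'), hv⟩
  refine ⟨fun k => (c k)⁻¹ - 1, fun m n hmn => sub_le_sub_right (hmono hmn) 1,
    tendsto_atTop_add_const_right _ (-1) htop, b, fun k => ?_⟩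
  exact G.mem_neumannGraph_iff.1 (G.smul_mem_neumannGraph (hc0 k).ne' (hc k))

/-- The min-max argument: the Poincaré inequality is applied to a mean-zero function in the span of
the first two eigenfunctions. With indices from `0`, the second eigenvalue is `μ 1`. -/
theorem two_le_mul_eigenvalue {L D : ℝ} (hL : HasSum G.len L) (hL0 : 0 < L) (hD : 0 ≤ D)
    (hdiam : G.diam ≤ ENNReal.ofReal D) {μ : ℕ → ℝ}
    (hμ : IsEigenvalueSequence G.neumannLaplacian μ) : 2 ≤ L * D * μ 1 := by
  obtain ⟨hmono, -, ψ, hψ⟩ := hμ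
  obtain ⟨u, hu, hu'⟩ := G.mem_neumannGraph_iff.2 (hψ 0)
  obtain ⟨v, hv, hv'⟩ := G.mem_neumannGraph_iff.2 (hψ 1)
  have hn : ∀ k, inner ℝ (ψ k) (ψ k) = 1 := fun k => by
    rw [real_inner_self_eq_norm_sq, ψ.orthonormal.1, one_pow]
  have h01 : inner ℝ (ψ 0) (ψ 1) = 0 := ψ.orthonormal.2 zero_ne_one
  -- One linear condition on two coefficients has a nonzero solution; `ψ 0` need not be known to be
  -- constant.
  obtain ⟨a, b, hab, hmean⟩ : ∃ a b : ℝ, 0 < a ^ 2 + b ^ 2 ∧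
      inner ℝ (one hL.summable) (a • ψ 0 + b • ψ 1) = 0 := by
    simp only [inner_add_right, inner_smul_right]
    by_cases h : inner ℝ (one hL.summable) (ψ 0) = 0
    · exact ⟨1, 0, by norm_num, by rw [h]; ring⟩
    · exact ⟨inner ℝ (one hL.summable) (ψ 1), -inner ℝ (one hL.summable) (ψ 0),
        add_pos_of_nonneg_of_pos (sq_nonneg _) (by rw [neg_sq]; positivity), by ring⟩
  obtain ⟨f, hf⟩ := G.mem_H1_iff.1 (G.H1.add_mem (G.H1.smul_mem a hu) (G.H1.smul_mem b hv))
  have hP := hf.poincare hL hL0 hD hdiam hmean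
  have h1 : ‖a • ψ 0 + b • ψ 1‖ ^ 2 = a ^ 2 + b ^ 2 := by
    rw [norm_add_sq_real, inner_smul_left, inner_smul_right, h01]
    simp [norm_smul, ψ.orthonormal.1]
  -- Testing the weak eigenvalue equations with the eigenfunctions themselves: their derivatives are
  -- orthogonal, with squared norms the eigenvalues.
  have huu : ‖u‖ ^ 2 = μ 0 := by
    rw [← real_inner_self_eq_norm_sq, hu' _ _ hu, inner_smul_left, hn]; simp
  have hvv : ‖v‖ ^ 2 = μ 1 := by
    rw [← real_inner_self_eq_norm_sq, hv' _ _ hv, inner_smul_left, hn]; simp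
  have huv : inner ℝ u v = (0 : ℝ) := by
    rw [hu' _ _ hv, inner_smul_left, h01, mul_zero]
  have h2 : ‖a • u + b • v‖ ^ 2 = a ^ 2 * μ 0 + b ^ 2 * μ 1 := by
    rw [norm_add_sq_real, inner_smul_left, inner_smul_right, huv, norm_smul, norm_smul, mul_pow,
      mul_pow, huu, hvv]
    simp
  have hP' : 2 * ‖a • ψ 0 + b • ψ 1‖ ^ 2 ≤ L * D * ‖a • u + b • v‖ ^ 2 := hP
  rw [h1, h2] at hP'
  have h3 : a ^ 2 * μ 0 + b ^ 2 * μ 1 ≤ μ 1 * (a ^ 2 + b ^ 2) := by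
    have := mul_le_mul_of_nonneg_left (hmono zero_le_one) (sq_nonneg a)
    linarith
  have h4 : 2 * (a ^ 2 + b ^ 2) ≤ L * D * μ 1 * (a ^ 2 + b ^ 2) := by
    refine hP'.trans ((mul_le_mul_of_nonneg_left h3 (mul_nonneg hL0.le hD)).trans_eq ?_)
    ring
  exact le_of_mul_le_mul_right h4 hab

end MetricGraph

theorem mainTheorem10 {E : Type*} [Countable E] (G : MetricGraph E)
    (hfin : G.LocallyFinite) (hconn : G.Connected) (hbetti : G.bettiNumber ≠ ⊤)
    (L D : ℝ) (hL : 0 < L) (hD : 0 < D)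
    (hlength : G.totalLength = ENNReal.ofReal L) (hdiam : G.diam = ENNReal.ofReal D) :
    (∃ μ : ℕ → ℝ, IsEigenvalueSequence G.neumannLaplacian μ) ∧
      ∀ μ : ℕ → ℝ, IsEigenvalueSequence G.neumannLaplacian μ → 2 / (L * D) ≤ μ 1 := by
  have hsum := G.hasSum_len hL.le hlength
  -- An empty edge set would have total length `0`.
  have : Nonempty E := by
    by_contra h
    rw [not_nonempty_iff] at h
    exact hL.ne' (hsum.unique hasSum_empty)
  refine ⟨MetricGraph.exists_isEigenvalueSequence hsum (by positivity)
    fun f p hf => hf.sq_le hsum hL hD.le hdiam.le, fun μ hμ => ?_⟩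
  rw [div_le_iff₀ (by positivity), mul_comm]
  exact MetricGraph.two_le_mul_eigenvalue hsum hL hD.le hdiam.le hμ
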